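/- Let $A,B$ be positive semidefinite complex $n\times n$ matrices. Write $X\le Y$ if $Y-X$ is positive semidefinite. For Hermitian $T$ let $\{T>0\}$ be the orthogonal projection on the span of the eigenvectors of $T$ with positive eigenvalues, and $T_+=T\{T>0\}$, $T_-=(-T)_+$, so that $T=T_+-T_-$. Put $O_\gamma(A\|B)=(A-\gamma B)_+$ and, for $t\ge 1$, $$G(t)=\int_1^t\big(\gamma^{-1}O_\gamma(A\|B)+\gamma^{-2}O_\gamma(B\|A)\big)\,d\gamma .$$ Let $$\Delta(A\|B)=A(\log A-\log B)-B\,D\log[B](A)+B,\qquad D\log[B](A)=\lim_{t\to0}\frac{\log(B+tA)-\log B}{t},$$ where the logarithm of a positive semidefinite matrix is taken on its range and extended by $0$ on its kernel (so it is the usual logarithm if the matrix is positive definite). Let $D(A\|B)=\operatorname{tr}\big(A(\log A-\log B)-A+B\big)\in(-\infty,\infty]$, where $\operatorname{tr}(A\log B)=\sum_j (v_j^*Av_j)\log b_j$ over an orthonormal eigenbasis $v_j$ of $B$ with eigenvalues $b_j$, with $\log 0=-\infty$, $0\cdot(-\infty)=0$ and $0\log 0=0$. Let $\|\cdot\|$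 be the operator norm. Then the following dichotomy holds. 1. Assume that $A\le\tau B$ for some real $\tau\ge1$. Then the limit $D\log[B](A)$ exists, $\Delta(A\|B)$ is positive semidefinite, the integral below converges absolutely, and $$\Delta(A\|B)=\int_1^\infty\big(\gamma^{-1}O_\gamma(A\|B)+\gamma^{-2}O_\gamma(B\|A)\big)\,d\gamma .$$ Moreover, with respect to $\mathbb C^n=\operatorname{range}B\oplus\ker B$ one has $A=A_1\oplus0$ and $B=B_1\oplus 0$, where $A_1,B_1$ are the restrictions of $A,B$ to $\operatorname{range}B$ and $B_1$ is positive definite, the limit $D\log[B_1](A_1)$ exists, and $\Delta(A\|B)=\Delta(A_1\|B_1)\oplus0$. 2. Assume that there is no $\tau\ge1$ with $A\le\tau B$. Then the integrals $G(t)$, $t\ge1$, are positive semidefinite and nondecreasing in $t$, and there is $x\in\mathbb C^n$ with $Bx=0$, $x^*Ax>0$ and $\lim_{t\to\infty}x^*G(t)x=\infty$; hence $\lim_{t\to\infty}\|G(t)\|=\infty$. In particular, both sides of Frenkel's trace formula $$D(A\|B)=\int_{-\infty}^{\infty}\frac{dt}{|t|(t-1)^2}\operatorname{tr}\big((1-t)A+tB\big)_-$$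 are equal to $\infty$. -/

import Mathlib

open scoped ComplexOrder Matrix Matrix.Norms.L2Operator
open MeasureTheory Filter Topology

noncomputable section

namespace OperatorFrenkel

/-- The projection `{T > 0}` on the positive spectrum of a Hermitian matrix `T`. -/
def posProj {n : ℕ} (T : Matrix (Fin n) (Fin n) ℂ) : Matrix (Fin n) (Fin n) ℂ :=
  cfc (fun x : ℝ => if 0 < x then (1 : ℝ) else 0) T

/-- The positive part `T₊ = T {T > 0}` of a Hermitian matrix `T`. -/
def posPart {n : ℕ} (T : Matrix (Fin n) (Fin n) ℂ) : Matrix (Fin n) (Fin n) ℂ :=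
  T * posProj T

/-- The negative part `T₋ = (-T)₊ ≥ 0` of a Hermitian matrix `T`, so that `T = T₊ - T₋`. -/
def negPart {n : ℕ} (T : Matrix (Fin n) (Fin n) ℂ) : Matrix (Fin n) (Fin n) ℂ :=
  posPart (-T)

/-- `O_γ(A‖B) = (A - γ B)₊`. -/
def O {n : ℕ} (γ : ℝ) (A B : Matrix (Fin n) (Fin n) ℂ) : Matrix (Fin n) (Fin n) ℂ :=
  posPart (A - γ • B)

/-- The integrand `γ⁻¹ O_γ(A‖B) + γ⁻² O_γ(B‖A)`. -/
def integrand {n : ℕ} (A B : Matrix (Fin n) (Fin n) ℂ) (γ : ℝ) : Matrix (Fin n) (Fin n) ℂ :=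
  γ⁻¹ • O γ A B + (γ ^ 2)⁻¹ • O γ B A

/-- The partial integral `∫₁ᵗ (γ⁻¹ O_γ(A‖B) + γ⁻² O_γ(B‖A)) dγ`. -/
def partialIntegral {n : ℕ} (A B : Matrix (Fin n) (Fin n) ℂ) (t : ℝ) :
    Matrix (Fin n) (Fin n) ℂ :=
  ∫ γ in (1 : ℝ)..t, integrand A B γ

/-- The directional derivative `D log[B](A) = lim_{t → 0} (log (B + t A) - log B) / t`. -/
def Dlog {n : ℕ} (B A : Matrix (Fin n) (Fin n) ℂ) : Matrix (Fin n) (Fin n) ℂ :=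
  lineDeriv ℝ CFC.log B A

/-- The divergence operator `Δ(A‖B) = A (log A - log B) - B D log[B](A) + B`. Here `CFC.log` is
defined by functional calculus from `Real.log`, and `Real.log 0 = 0`: the logarithm of a singular
positive semidefinite matrix is taken on its range and extended by `0` on its kernel. -/
def Δ {n : ℕ} (A B : Matrix (Fin n) (Fin n) ℂ) : Matrix (Fin n) (Fin n) ℂ :=
  A * (CFC.log A - CFC.log B) - B * Dlog B A + B

/-- The columns of `V` are an orthonormal basis of the range of `B`. For such a `V`, the operators
`A|Bℂⁿ` (when `A` maps `Bℂⁿ` to itself) and `B|Bℂⁿ` have the matrices `Vᴴ A V` and `Vᴴ B V` in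
that basis, and `V S Vᴴ` is the matrix of `S ⊕ 0` with respect to
`ℂⁿ = range B ⊕ (range B)ᗮ`. -/
def IsRangeBasis {n r : ℕ} (B : Matrix (Fin n) (Fin n) ℂ) (V : Matrix (Fin n) (Fin r) ℂ) : Prop :=
  Vᴴ * V = 1 ∧ LinearMap.range V.mulVecLin = LinearMap.range B.mulVecLin

/-- `tr (A log B)` in the extended reals: `∑ⱼ (vⱼ* A vⱼ) log bⱼ` over an orthonormal eigenbasis
`vⱼ` of `B ≥ 0` with eigenvalues `bⱼ`, where `log 0 = -∞` and `0 · (-∞) = 0`. -/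
def trMulLog {n : ℕ} (A : Matrix (Fin n) (Fin n) ℂ) {B : Matrix (Fin n) (Fin n) ℂ}
    (hB : B.IsHermitian) : EReal :=
  ∑ j, (((star (hB.eigenvectorBasis j).ofLp ⬝ᵥ A *ᵥ (hB.eigenvectorBasis j).ofLp).re : ℝ) : EReal)
    * ENNReal.log (ENNReal.ofReal (hB.eigenvalues j))

/-- The divergence `D(A‖B) = tr (A (log A - log B) - A + B)` of `A, B ≥ 0`, in the extended reals. -/
def divergence {n : ℕ} (A : Matrix (Fin n) (Fin n) ℂ) {B : Matrix (Fin n) (Fin n) ℂ}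
    (hB : B.IsHermitian) : EReal :=
  (((A * CFC.log A - A + B).trace.re : ℝ) : EReal) - trMulLog A hB

/-- The right side `∫_{-∞}^{∞} dt / (|t| (t - 1)²) tr ((1 - t) A + t B)₋` of Frenkel's trace
formula; the integrand is nonnegative and the value lies in `[0, ∞]`. -/
def frenkelIntegral {n : ℕ} (A B : Matrix (Fin n) (Fin n) ℂ) : ENNReal :=
  ∫⁻ t : ℝ, ENNReal.ofReal
    ((|t| * (t - 1) ^ 2)⁻¹ * (negPart ((1 - t) • A + t • B)).trace.re)

end OperatorFrenkel

end

open scoped ComplexOrder Matrix Matrix.Norms.L2Operator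
open MeasureTheory Filter Topology

noncomputable section

namespace OperatorFrenkel

/-! The proof is a contour integral of a resolvent kernel. For positive definite $B$, write
$R_M(y)=(M+iy)^{-1}$ and, for $\operatorname{Im}E\ge0$ and $y>0$, put $X=A+EB$ and $Y=(1+E)B$. The
difference $X-Y=A-B=C$ does not depend on $E$, and the kernel `psi` is $-y\,R_YCR_XCR_Y$. At $E=0$
its integral over $y>0$ is $\Delta(A\|B)$ (`integral_psi_zero`): the logarithm and its derivative
are integrals of resolvents on the imaginary axis, and the resolvent identity collapses their
combination.

The kernel is holomorphic in $E$, so $\psi\,dE/E$ integrates to zero around a half annulus in the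
upper half plane (`contour_psi`). The large arc vanishes in the limit and the small arc gives
$\pi\psi(0)$. There remain the imaginary parts on the real axis. After integration over $y$ these
are explicit (`integral_im_psi`): the three terms of $\psi$ contribute $\frac\pi2$ times $-|X|$,
$|Y|$ and $\operatorname{sign}(1+E)\,C$. As $|Y|=\operatorname{sign}(1+E)\,Y$ and $Y+C=X$, the sum
is $-\pi X_-$ if $1+E>0$ and $-\pi X_+$ if $1+E<0$. This is zero for $E\ge0$; on $E=-\gamma<0$ it
produces $O_\gamma(A\|B)$ for $\gamma>1$ and, after inversion $\gamma\mapsto1/\gamma$,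
$O_\gamma(B\|A)$. Everything is tested on quadratic forms, which determine a complex matrix.

For singular $B$, domination $A\le\tau B$ is equivalent to $\ker B\subseteq\ker A$. Both matrices
then live on the range of $B$, and functional calculus by functions vanishing at $0$, including
`Real.log`, commutes with the compression.

Without domination some eigenvector $x$ in $\ker B$ has $x^*Ax>0$. Then $x^*O_\gamma(A\|B)x\ge
x^*Ax$, whence $x^*G(t)x\ge x^*Ax\,\log t$. The same vector makes $\operatorname{tr}(A\log
B)=-\infty$ and gives the integrand of the trace formula a singularity of order at least $1/(t-1)$
as $t\downarrow1$. -/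

/-- The quadratic form `x* M x`. -/
def qf {n : ℕ} (x : Fin n → ℂ) (M : Matrix (Fin n) (Fin n) ℂ) : ℂ := star x ⬝ᵥ M *ᵥ x

/-- The squared Euclidean norm of a vector. -/
def nsq {n : ℕ} (x : Fin n → ℂ) : ℝ := ∑ i, ‖x i‖ ^ 2

/-! ### Quadratic forms, norms and invertibility -/

section QuadraticForm

variable {n : ℕ} (x : Fin n → ℂ) (M N : Matrix (Fin n) (Fin n) ℂ)

lemma nsq_nonneg : 0 ≤ nsq x := Finset.sum_nonneg fun _ _ => by positivity

lemma nsq_eq_norm_sq : nsq x = ‖(WithLp.toLp 2 x : EuclideanSpace ℂ (Fin n))‖ ^ 2 := by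
  rw [EuclideanSpace.norm_sq_eq]; rfl

lemma nsq_pos {x : Fin n → ℂ} (hx : x ≠ 0) : 0 < nsq x := by
  rw [nsq_eq_norm_sq]
  have : (WithLp.toLp 2 x : EuclideanSpace ℂ (Fin n)) ≠ 0 := by simpa using hx
  positivity

lemma star_dotProduct_self : star x ⬝ᵥ x = (nsq x : ℂ) := by
  simp only [nsq, dotProduct, Pi.star_apply, RCLike.star_def, Complex.ofReal_sum]
  refine Finset.sum_congr rfl fun i _ => ?_
  rw [Complex.conj_mul']; norm_cast

lemma qf_add : qf x (M + N) = qf x M + qf x N := by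
  simp [qf, Matrix.add_mulVec, dotProduct_add]

lemma qf_sub : qf x (M - N) = qf x M - qf x N := by
  simp [qf, Matrix.sub_mulVec, dotProduct_sub]

lemma qf_neg : qf x (-M) = -qf x M := by
  simp [qf, Matrix.neg_mulVec]

lemma qf_smul (c : ℂ) : qf x (c • M) = c * qf x M := by
  simp [qf, Matrix.smul_mulVec]

lemma qf_real_smul (c : ℝ) : qf x (c • M) = c * qf x M := by
  simp [qf, Matrix.smul_mulVec]

lemma qf_one : qf x 1 = nsq x := by simp [qf, star_dotProduct_self]

lemma qf_zero : qf x 0 = 0 := by simp [qf]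

lemma qf_conjTranspose : qf x Mᴴ = star (qf x M) := by
  simp only [qf]
  rw [Matrix.star_dotProduct, Matrix.star_mulVec, Matrix.dotProduct_mulVec]
  simp [dotProduct_comm]

lemma qf_mul_mul_conjTranspose {m : ℕ} (V : Matrix (Fin n) (Fin m) ℂ)
    (L : Matrix (Fin m) (Fin m) ℂ) : qf x (V * L * Vᴴ) = qf (Vᴴ *ᵥ x) L := by
  simp only [qf, Matrix.star_mulVec, Matrix.conjTranspose_conjTranspose, ← Matrix.mulVec_mulVec,
    Matrix.dotProduct_mulVec, Matrix.vecMul_vecMul, Matrix.mul_assoc]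

lemma qf_eq_sum : qf x M = ∑ i, ∑ j, star (x i) * M i j * x j := by
  simp only [qf, dotProduct, Matrix.mulVec, Finset.mul_sum, Pi.star_apply, mul_assoc]

lemma qf_diagonal (d : Fin n → ℂ) : qf x (Matrix.diagonal d) = ∑ i, d i * (‖x i‖ : ℂ) ^ 2 := by
  simp only [qf, dotProduct, Matrix.mulVec_diagonal, Pi.star_apply, RCLike.star_def]
  refine Finset.sum_congr rfl fun i _ => ?_
  rw [← Complex.conj_mul']; ring

lemma norm_qf_le : ‖qf x M‖ ≤ ‖M‖ * nsq x := by
  set z : EuclideanSpace ℂ (Fin n) := WithLp.toLp 2 x with hz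
  have h : qf x M = inner ℂ z (Matrix.toEuclideanCLM (n := Fin n) (𝕜 := ℂ) M z) := by
    rw [hz, Matrix.toEuclideanCLM_toLp, EuclideanSpace.inner_toLp_toLp, dotProduct_comm]; rfl
  rw [h, nsq_eq_norm_sq]
  refine (norm_inner_le_norm _ _).trans ?_
  have := (Matrix.toEuclideanCLM (n := Fin n) (𝕜 := ℂ) M).le_opNorm z
  rw [Matrix.l2_opNorm_toEuclideanCLM] at this
  nlinarith [norm_nonneg z]

/-- The Lax–Milgram argument: $c\|w\|^2\le|\langle w,Mw\rangle|\le\|w\|\,\|Mw\|$. All resolvent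
bounds below come from it, also for non-Hermitian $M$. -/
lemma isUnit_and_norm_inv_le {M : Matrix (Fin n) (Fin n) ℂ} {c : ℝ} (hc : 0 < c)
    (h : ∀ x, c * nsq x ≤ ‖qf x M‖) : IsUnit M ∧ ‖M⁻¹‖ ≤ c⁻¹ := by
  have hu : IsUnit M := by
    rw [← Matrix.mulVec_injective_iff_isUnit]
    refine (injective_iff_map_eq_zero (Matrix.mulVecLin M)).mpr fun x hx => ?_
    by_contra hx0
    have h1 := h x
    have h2 : qf x M = 0 := by
      have : M *ᵥ x = 0 := hx
      simp [qf, this]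
    rw [h2, norm_zero] at h1
    have := nsq_pos hx0
    nlinarith
  refine ⟨hu, ?_⟩
  rw [← Matrix.l2_opNorm_toEuclideanCLM]
  refine ContinuousLinearMap.opNorm_le_bound _ (by positivity) fun z => ?_
  set w : EuclideanSpace ℂ (Fin n) := Matrix.toEuclideanCLM (n := Fin n) (𝕜 := ℂ) M⁻¹ z with hw
  have hMw : M *ᵥ w.ofLp = z.ofLp := by
    rw [hw, Matrix.ofLp_toEuclideanCLM, Matrix.mulVec_mulVec,
      Matrix.mul_nonsing_inv _ ((Matrix.isUnit_iff_isUnit_det _).mp hu), Matrix.one_mulVec]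
  have h1 := h w.ofLp
  have h2 : qf w.ofLp M = inner ℂ w z := by
    rw [EuclideanSpace.inner_eq_star_dotProduct, dotProduct_comm, ← hMw]; rfl
  rw [h2, nsq_eq_norm_sq] at h1
  have h3 := norm_inner_le_norm (𝕜 := ℂ) w z
  change c * ‖w‖ ^ 2 ≤ _ at h1
  rw [inv_mul_eq_div, le_div_iff₀ hc]
  by_cases hw0 : ‖w‖ = 0
  · rw [hw0]; simp
  · have : 0 < ‖w‖ := lt_of_le_of_ne (norm_nonneg _) (Ne.symm hw0)
    nlinarith

/-- The quadratic form at `x` as a continuous linear functional. -/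
def qfCLM : Matrix (Fin n) (Fin n) ℂ →L[ℂ] ℂ :=
  LinearMap.toContinuousLinearMap
    { toFun := qf x, map_add' := qf_add x, map_smul' := fun c M => by simp [qf_smul] }

@[simp] lemma qfCLM_apply : qfCLM x M = qf x M := rfl

lemma continuous_qf : Continuous (qf x) := (qfCLM x).continuous

/-- Polarization over $\mathbb C$; no Hermitian assumption is needed. -/
lemma eq_zero_of_qf_eq_zero {M : Matrix (Fin n) (Fin n) ℂ} (h : ∀ x, qf x M = 0) : M = 0 := by
  have h1 : (Matrix.toEuclideanCLM (n := Fin n) (𝕜 := ℂ) M :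
      EuclideanSpace ℂ (Fin n) →ₗ[ℂ] EuclideanSpace ℂ (Fin n)) = 0 := by
    rw [← inner_map_self_eq_zero]
    intro z
    have := h z.ofLp
    rw [← inner_conj_symm, EuclideanSpace.inner_eq_star_dotProduct, dotProduct_comm]
    simpa [qf] using this
  have h2 : Matrix.toEuclideanCLM (n := Fin n) (𝕜 := ℂ) M = 0 := by
    ext1 z; exact congrArg (fun f => f z) h1
  exact (map_eq_zero_iff _ (Matrix.toEuclideanCLM (n := Fin n) (𝕜 := ℂ)).injective).mp h2

lemma ext_qf {M N : Matrix (Fin n) (Fin n) ℂ} (h : ∀ x, qf x M = qf x N) : M = N :=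
  sub_eq_zero.mp (eq_zero_of_qf_eq_zero fun x => by rw [qf_sub, h, sub_self])

lemma _root_.Matrix.IsHermitian.qf_im {M : Matrix (Fin n) (Fin n) ℂ} (hM : M.IsHermitian) :
    (qf x M).im = 0 := by
  have := qf_conjTranspose x M
  rw [hM.eq] at this
  have h2 := congrArg Complex.im this
  simp at h2; linarith

lemma isHermitian_of_qf_im {M : Matrix (Fin n) (Fin n) ℂ} (h : ∀ x, (qf x M).im = 0) :
    M.IsHermitian :=
  ext_qf fun x => by
    rw [qf_conjTranspose]
    exact Complex.conj_eq_iff_im.mpr (h x)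

lemma posSemidef_iff_qf {M : Matrix (Fin n) (Fin n) ℂ} :
    M.PosSemidef ↔ ∀ x, 0 ≤ (qf x M).re ∧ (qf x M).im = 0 := by
  rw [Matrix.posSemidef_iff_dotProduct_mulVec]
  constructor
  · exact fun h x => ⟨(Complex.le_def.mp (h.2 x)).1, h.1.qf_im x⟩
  · exact fun h => ⟨isHermitian_of_qf_im fun x => (h x).2,
      fun x => Complex.le_def.mpr ⟨(h x).1, (h x).2.symm⟩⟩

lemma _root_.Matrix.PosSemidef.qf_re {M : Matrix (Fin n) (Fin n) ℂ} (hM : M.PosSemidef) :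
    0 ≤ (qf x M).re := (posSemidef_iff_qf.mp hM x).1

lemma _root_.Matrix.IsHermitian.qf_eq_re {M : Matrix (Fin n) (Fin n) ℂ} (hM : M.IsHermitian) :
    qf x M = ((qf x M).re : ℂ) := Complex.ext (by simp) (by simp [hM.qf_im])

end QuadraticForm

/-! ### Functional calculus in an eigenbasis -/

section Spectral

variable {n : ℕ} {X : Matrix (Fin n) (Fin n) ℂ} (hX : X.IsHermitian)

/-- The complex-valued functional calculus of a Hermitian matrix by its eigendecomposition. -/
def spec (g : ℝ → ℂ) : Matrix (Fin n) (Fin n) ℂ :=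
  (hX.eigenvectorUnitary : Matrix (Fin n) (Fin n) ℂ) * Matrix.diagonal (fun j => g (hX.eigenvalues j))
    * (hX.eigenvectorUnitary : Matrix (Fin n) (Fin n) ℂ)ᴴ

lemma eigenvectorUnitary_conjTranspose_mul :
    (hX.eigenvectorUnitary : Matrix (Fin n) (Fin n) ℂ)ᴴ * hX.eigenvectorUnitary = 1 :=
  Unitary.coe_star_mul_self hX.eigenvectorUnitary

lemma eigenvectorUnitary_mul_conjTranspose :
    (hX.eigenvectorUnitary : Matrix (Fin n) (Fin n) ℂ) *
      (hX.eigenvectorUnitary : Matrix (Fin n) (Fin n) ℂ)ᴴ = 1 :=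
  Unitary.coe_mul_star_self hX.eigenvectorUnitary

lemma spec_mul (g h : ℝ → ℂ) : spec hX g * spec hX h = spec hX (fun a => g a * h a) := by
  simp only [spec]
  rw [show ∀ U D W D' : Matrix (Fin n) (Fin n) ℂ, U * D * W * (U * D' * W) =
    U * D * (W * U) * D' * W from fun U D W D' => by simp only [Matrix.mul_assoc],
    eigenvectorUnitary_conjTranspose_mul, Matrix.mul_one, Matrix.mul_assoc (hX.eigenvectorUnitary : Matrix (Fin n) (Fin n) ℂ),
    Matrix.diagonal_mul_diagonal]

lemma spec_add (g h : ℝ → ℂ) : spec hX g + spec hX h = spec hX (fun a => g a + h a) := by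
  simp only [spec]
  rw [← Matrix.diagonal_add, Matrix.mul_add, Matrix.add_mul]

lemma spec_smul (c : ℂ) (g : ℝ → ℂ) : c • spec hX g = spec hX (fun a => c * g a) := by
  simp only [spec]
  rw [← Matrix.smul_mul, ← Matrix.mul_smul, ← Matrix.diagonal_smul]
  rfl

lemma spec_const (c : ℂ) : spec hX (fun _ => c) = c • 1 := by
  simp only [spec]
  rw [show (Matrix.diagonal fun _ : Fin n => c) = c • (1 : Matrix (Fin n) (Fin n) ℂ) by
    rw [← Matrix.diagonal_one, ← Matrix.diagonal_smul]; congr; ext; simp]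
  rw [Matrix.mul_smul, Matrix.smul_mul, Matrix.mul_one, eigenvectorUnitary_mul_conjTranspose]

lemma spec_ofReal : spec hX (fun a => (a : ℂ)) = X := by
  conv_rhs => rw [hX.spectral_theorem]
  rfl

lemma cfc_eq_spec (f : ℝ → ℝ) : cfc f X = spec hX (fun a => (f a : ℂ)) := by
  rw [hX.cfc_eq]; rfl

lemma spec_congr {g h : ℝ → ℂ} (H : ∀ j, g (hX.eigenvalues j) = h (hX.eigenvalues j)) :
    spec hX g = spec hX h := by
  simp only [spec, H]

/-- The coordinates of `x` in the eigenbasis. -/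
def coord (x : Fin n → ℂ) : Fin n → ℂ :=
  (hX.eigenvectorUnitary : Matrix (Fin n) (Fin n) ℂ)ᴴ *ᵥ x

lemma qf_spec (x : Fin n → ℂ) (g : ℝ → ℂ) :
    qf x (spec hX g) = ∑ j, g (hX.eigenvalues j) * (‖coord hX x j‖ : ℂ) ^ 2 := by
  rw [spec, qf_mul_mul_conjTranspose, qf_diagonal]; rfl

lemma nsq_coord (x : Fin n → ℂ) : nsq (coord hX x) = nsq x := by
  have := qf_spec hX x (fun _ => 1)
  rw [spec_const, one_smul, qf_one] at this
  simp only [one_mul] at this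
  simp only [nsq] at this ⊢
  exact_mod_cast this.symm

lemma inv_spec {g : ℝ → ℂ} (hg : ∀ j, g (hX.eigenvalues j) ≠ 0) :
    (spec hX g)⁻¹ = spec hX (fun a => (g a)⁻¹) := by
  refine Matrix.inv_eq_right_inv ?_
  rw [spec_mul, ← one_smul ℂ (1 : Matrix (Fin n) (Fin n) ℂ), ← spec_const hX]
  exact spec_congr hX fun j => mul_inv_cancel₀ (hg j)

/-- The functional calculus is a linear map of the finite vector of values at the eigenvalues, so a
matrix integral reduces to one scalar integral for each eigenvalue. -/
lemma integral_spec {f : ℝ → ℝ → ℂ} {F : ℝ → ℂ} {s : Set ℝ}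
    (hi : ∀ j, IntegrableOn (fun y => f y (hX.eigenvalues j)) s)
    (hF : ∀ j, ∫ y in s, f y (hX.eigenvalues j) = F (hX.eigenvalues j)) :
    IntegrableOn (fun y => spec hX (f y)) s ∧ ∫ y in s, spec hX (f y) = spec hX F := by
  let L : (Fin n → ℂ) →L[ℂ] Matrix (Fin n) (Fin n) ℂ := LinearMap.toContinuousLinearMap
    { toFun := fun d => (hX.eigenvectorUnitary : Matrix (Fin n) (Fin n) ℂ) * Matrix.diagonal d
        * (hX.eigenvectorUnitary : Matrix (Fin n) (Fin n) ℂ)ᴴ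
      map_add' := fun d e => by
        rw [show d + e = fun i => d i + e i from rfl, ← Matrix.diagonal_add, Matrix.mul_add,
          Matrix.add_mul]
      map_smul' := fun c d => by
        rw [Matrix.diagonal_smul, Matrix.mul_smul, Matrix.smul_mul]; rfl }
  have hi' : IntegrableOn (fun y j => f y (hX.eigenvalues j)) s := Integrable.of_eval hi
  have hL : ∀ g, spec hX g = L (fun j => g (hX.eigenvalues j)) := fun g => rfl
  simp only [hL]
  refine ⟨L.integrable_comp hi', ?_⟩
  rw [L.integral_comp_comm hi']
  congr 1
  ext j
  rw [eval_integral hi, hF]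

end Spectral

/-! ### Scalar integrals over the half line -/

section ScalarIntegrals

lemma tendsto_div_atTop_atTop {p : ℝ} (hp : 0 < p) : Tendsto (fun y : ℝ => y / p) atTop atTop :=
  tendsto_id.atTop_div_const hp

lemma hasDerivAt_arctan_div {p : ℝ} (hp : 0 < p) (y : ℝ) :
    HasDerivAt (fun y => Real.arctan (y / p)) (p / (p ^ 2 + y ^ 2)) y := by
  have h := ((hasDerivAt_id y).div_const p).arctan
  refine h.congr_deriv ?_
  have : p ^ 2 + y ^ 2 ≠ 0 := by positivity
  change 1 / (1 + (y / p) ^ 2) * (1 / p) = _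
  field_simp

lemma tendsto_arctan_div {p : ℝ} (hp : 0 < p) :
    Tendsto (fun y => Real.arctan (y / p)) atTop (𝓝 (Real.pi / 2)) :=
  (Real.tendsto_arctan_atTop.mono_right nhdsWithin_le_nhds).comp (tendsto_div_atTop_atTop hp)

lemma integral_div_sq_add_sq {p : ℝ} (hp : 0 < p) :
    IntegrableOn (fun y : ℝ => p / (p ^ 2 + y ^ 2)) (Set.Ioi 0) ∧
      ∫ y in Set.Ioi (0 : ℝ), p / (p ^ 2 + y ^ 2) = Real.pi / 2 := by
  have hd := hasDerivAt_arctan_div hp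
  have hc : ContinuousWithinAt (fun y => Real.arctan (y / p)) (Set.Ici 0) 0 :=
    (hd 0).continuousAt.continuousWithinAt
  have hi : IntegrableOn (fun y : ℝ => p / (p ^ 2 + y ^ 2)) (Set.Ioi 0) :=
    integrableOn_Ioi_deriv_of_nonneg hc (fun y _ => hd y) (fun y _ => by positivity)
      (tendsto_arctan_div hp)
  refine ⟨hi, ?_⟩
  rw [integral_Ioi_of_hasDerivAt_of_tendsto hc (fun y _ => hd y) hi (tendsto_arctan_div hp)]
  simp

lemma integral_const_div_sq_add_sq {m : ℝ} (hm : 0 < m) (K : ℝ) :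
    IntegrableOn (fun y : ℝ => K / (m ^ 2 + y ^ 2)) (Set.Ioi 0) ∧
      ∫ y in Set.Ioi (0 : ℝ), K / (m ^ 2 + y ^ 2) = K / m * (Real.pi / 2) := by
  have h := integral_div_sq_add_sq hm
  have he : (fun y : ℝ => K / (m ^ 2 + y ^ 2)) = fun y => K / m * (m / (m ^ 2 + y ^ 2)) := by
    ext y; field_simp
  rw [he]
  exact ⟨h.1.const_mul _, by rw [integral_const_mul, h.2]⟩

lemma integral_sq_div_sq_add_sq (a : ℝ) :
    IntegrableOn (fun y : ℝ => a ^ 2 / (a ^ 2 + y ^ 2)) (Set.Ioi 0) ∧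
      ∫ y in Set.Ioi (0 : ℝ), a ^ 2 / (a ^ 2 + y ^ 2) = Real.pi / 2 * |a| := by
  rcases eq_or_ne a 0 with rfl | ha
  · simp
  · have h := integral_const_div_sq_add_sq (abs_pos.mpr ha) (a ^ 2)
    rw [sq_abs] at h
    refine ⟨h.1, h.2.trans ?_⟩
    have : |a| ≠ 0 := abs_ne_zero.mpr ha
    rw [← sq_abs]; field_simp

/-- The value is independent of $p$ and $q$; this is what turns the double sum over eigenvalues in
`integral_im_res_mul_res` into a multiple of $C$ itself. For $p\ne q$, partial fractions reduce it
to $\frac\pi2(p-q)/(p-q)$; the case $p=q$ has its own primitive. -/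
lemma integral_sq_mul_add_div {p q : ℝ} (hp : 0 < p) (hq : 0 < q) :
    IntegrableOn (fun y : ℝ => y ^ 2 * (p + q) / ((p ^ 2 + y ^ 2) * (q ^ 2 + y ^ 2))) (Set.Ioi 0) ∧
      ∫ y in Set.Ioi (0 : ℝ), y ^ 2 * (p + q) / ((p ^ 2 + y ^ 2) * (q ^ 2 + y ^ 2)) =
        Real.pi / 2 := by
  rcases eq_or_ne p q with rfl | hpq
  · have hd : ∀ y : ℝ, HasDerivAt (fun y => Real.arctan (y / p) - p * y / (p ^ 2 + y ^ 2))
        (y ^ 2 * (p + p) / ((p ^ 2 + y ^ 2) * (p ^ 2 + y ^ 2))) y := by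
      intro y
      have h1 := hasDerivAt_arctan_div hp y
      have h2 : HasDerivAt (fun y : ℝ => p * y / (p ^ 2 + y ^ 2))
          ((p * (p ^ 2 + y ^ 2) - p * y * (2 * y)) / (p ^ 2 + y ^ 2) ^ 2) y := by
        have h3 : HasDerivAt (fun y : ℝ => p * y) p y := by
          simpa using (hasDerivAt_id y).const_mul p
        have h4 : HasDerivAt (fun y : ℝ => p ^ 2 + y ^ 2) (2 * y) y := by
          simpa using (hasDerivAt_pow 2 y).const_add (p ^ 2)
        exact h3.div h4 (by positivity)
      refine (h1.sub h2).congr_deriv ?_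
      have : p ^ 2 + y ^ 2 ≠ 0 := by positivity
      field_simp
      ring
    have hc : ContinuousWithinAt (fun y => Real.arctan (y / p) - p * y / (p ^ 2 + y ^ 2))
        (Set.Ici 0) 0 := (hd 0).continuousAt.continuousWithinAt
    have ht : Tendsto (fun y => Real.arctan (y / p) - p * y / (p ^ 2 + y ^ 2)) atTop
        (𝓝 (Real.pi / 2)) := by
      have h1 : Tendsto (fun y : ℝ => p * y / (p ^ 2 + y ^ 2)) atTop (𝓝 0) := by
        refine squeeze_zero' (g := fun y => p / y) ?_ ?_ (tendsto_const_nhds.div_atTop tendsto_id)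
        · filter_upwards [eventually_ge_atTop 0] with y hy
          positivity
        · filter_upwards [eventually_gt_atTop 0] with y hy
          rw [div_le_div_iff₀ (by positivity) hy]
          nlinarith [pow_pos hp 3]
      simpa using (tendsto_arctan_div hp).sub h1
    have hi := integrableOn_Ioi_deriv_of_nonneg hc (fun y _ => hd y)
      (fun y _ => by positivity) ht
    refine ⟨hi, ?_⟩
    rw [integral_Ioi_of_hasDerivAt_of_tendsto hc (fun y _ => hd y) hi ht]
    simp
  · have hpos : ∀ c : ℝ, 0 < c → ∀ y : ℝ, c ^ 2 + y ^ 2 ≠ 0 := fun c hc y => by positivity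
    have he : (fun y : ℝ => y ^ 2 * (p + q) / ((p ^ 2 + y ^ 2) * (q ^ 2 + y ^ 2))) =
        fun y => (p - q)⁻¹ * (p ^ 2 / (p ^ 2 + y ^ 2) - q ^ 2 / (q ^ 2 + y ^ 2)) := by
      ext y
      have : p - q ≠ 0 := sub_ne_zero.mpr hpq
      rw [div_sub_div _ _ (hpos p hp y) (hpos q hq y), ← div_eq_inv_mul, div_div,
        div_eq_div_iff (mul_ne_zero (hpos p hp y) (hpos q hq y))
          (mul_ne_zero (mul_ne_zero (hpos p hp y) (hpos q hq y)) this)]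
      ring
    have h1 := integral_sq_div_sq_add_sq p
    have h2 := integral_sq_div_sq_add_sq q
    rw [he]
    refine ⟨(h1.1.sub h2.1).const_mul _, ?_⟩
    have : p - q ≠ 0 := sub_ne_zero.mpr hpq
    rw [integral_const_mul, integral_sub h1.1 h2.1, h1.2, h2.2, abs_of_pos hp, abs_of_pos hq]
    field_simp

lemma ofReal_add_mul_I_ne_zero {a y : ℝ} (h : a ≠ 0 ∨ y ≠ 0) :
    (a : ℂ) + y * Complex.I ≠ 0 := by
  intro h0
  have h1 := congrArg Complex.re h0
  have h2 := congrArg Complex.im h0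
  simp at h1 h2
  tauto

lemma norm_ofReal_add_mul_I (a y : ℝ) : ‖(a : ℂ) + y * Complex.I‖ = √(a ^ 2 + y ^ 2) :=
  Complex.norm_add_mul_I a y

lemma hasDerivAt_ofReal_add_mul_I (a y : ℝ) :
    HasDerivAt (fun y : ℝ => (a : ℂ) + y * Complex.I) Complex.I y := by
  simpa using (Complex.ofRealCLM.hasDerivAt (x := y)).mul_const Complex.I |>.const_add (a : ℂ)

/-- A primitive is $\log(b+iy)-\log(a+iy)$, smooth because both arguments stay in the right half
plane. It vanishes at infinity: both moduli are asymptotic to $y$ and both arguments tend to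
$\pi/2$. -/
lemma integral_sub_inv_eq_log {a b : ℝ} (ha : 0 < a) (hb : 0 < b) :
    IntegrableOn (fun y : ℝ => Complex.I *
        (((b : ℂ) + y * Complex.I)⁻¹ - ((a : ℂ) + y * Complex.I)⁻¹)) (Set.Ioi 0) ∧
      ∫ y in Set.Ioi (0 : ℝ), Complex.I *
        (((b : ℂ) + y * Complex.I)⁻¹ - ((a : ℂ) + y * Complex.I)⁻¹) =
        ((Real.log a - Real.log b : ℝ) : ℂ) := by
  have hne : ∀ c : ℝ, 0 < c → ∀ y : ℝ, (c : ℂ) + y * Complex.I ≠ 0 :=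
    fun c hc y => ofReal_add_mul_I_ne_zero (Or.inl hc.ne')
  have hd : ∀ c : ℝ, 0 < c → ∀ y : ℝ, HasDerivAt (fun y : ℝ => Complex.log ((c : ℂ) + y * Complex.I))
      (Complex.I * ((c : ℂ) + y * Complex.I)⁻¹) y := by
    intro c hc y
    have := (hasDerivAt_ofReal_add_mul_I c y).clog_real (Or.inl (by simpa using hc))
    simpa [div_eq_mul_inv] using this
  have hd2 : ∀ y : ℝ, HasDerivAt (fun y : ℝ => Complex.log ((b : ℂ) + y * Complex.I) -
      Complex.log ((a : ℂ) + y * Complex.I)) (Complex.I *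
        (((b : ℂ) + y * Complex.I)⁻¹ - ((a : ℂ) + y * Complex.I)⁻¹)) y := by
    intro y
    rw [mul_sub]
    exact (hd b hb y).sub (hd a ha y)
  have hcont : Continuous (fun y : ℝ => Complex.I *
        (((b : ℂ) + y * Complex.I)⁻¹ - ((a : ℂ) + y * Complex.I)⁻¹)) := by
    refine continuous_const.mul (Continuous.sub ?_ ?_)
    · exact Continuous.inv₀ (by fun_prop) (hne b hb)
    · exact Continuous.inv₀ (by fun_prop) (hne a ha)
  set m := min a b with hm
  have hm0 : 0 < m := lt_min ha hb
  have hi : IntegrableOn (fun y : ℝ => Complex.I *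
        (((b : ℂ) + y * Complex.I)⁻¹ - ((a : ℂ) + y * Complex.I)⁻¹)) (Set.Ioi 0) := by
    refine Integrable.mono' (integral_const_div_sq_add_sq hm0 |a - b|).1
      hcont.aestronglyMeasurable ?_
    refine ae_of_all _ fun y => ?_
    rw [inv_sub_inv (hne b hb y) (hne a ha y)]
    simp only [norm_mul, norm_div, Complex.norm_I, one_mul, norm_ofReal_add_mul_I]
    have h1 : ‖(a : ℂ) + y * Complex.I - (b + y * Complex.I)‖ = |a - b| := by
      rw [add_sub_add_right_eq_sub, ← Complex.ofReal_sub, Complex.norm_real, Real.norm_eq_abs]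
    rw [h1]
    refine div_le_div_of_nonneg_left (abs_nonneg _) (by positivity) ?_
    have h2 : √(m ^ 2 + y ^ 2) ≤ √(a ^ 2 + y ^ 2) :=
      Real.sqrt_le_sqrt (by nlinarith [min_le_left a b])
    have h3 : √(m ^ 2 + y ^ 2) ≤ √(b ^ 2 + y ^ 2) :=
      Real.sqrt_le_sqrt (by nlinarith [min_le_right a b])
    calc m ^ 2 + y ^ 2 = √(m ^ 2 + y ^ 2) * √(m ^ 2 + y ^ 2) :=
          (Real.mul_self_sqrt (by positivity)).symm
      _ ≤ _ := mul_le_mul h3 h2 (Real.sqrt_nonneg _) (Real.sqrt_nonneg _)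
  have ht : Tendsto (fun y : ℝ => Complex.log ((b : ℂ) + y * Complex.I) -
      Complex.log ((a : ℂ) + y * Complex.I)) atTop (𝓝 0) := by
    have hre : ∀ c : ℝ, 0 < c → Tendsto (fun y : ℝ => Real.log (√(c ^ 2 + y ^ 2)) - Real.log y)
        atTop (𝓝 0) := by
      intro c hc
      have h1 : Tendsto (fun y : ℝ => Real.log (√(c ^ 2 / y ^ 2 + 1))) atTop (𝓝 0) := by
        have h2 : Tendsto (fun y : ℝ => c ^ 2 / y ^ 2 + 1) atTop (𝓝 (0 + 1)) :=
          (tendsto_const_nhds.div_atTop (tendsto_pow_atTop two_ne_zero)).add_const 1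
        have h3 := (Real.continuous_sqrt.tendsto _).comp h2
        have h4 := (Real.continuousAt_log (x := √(0 + 1)) (by simp)).tendsto.comp h3
        rw [zero_add, Real.sqrt_one, Real.log_one] at h4
        exact h4
      refine h1.congr' ?_
      filter_upwards [eventually_gt_atTop 0] with y hy
      rw [← Real.log_div (by positivity) hy.ne']
      congr 1
      rw [eq_div_iff hy.ne', ← Real.sqrt_sq hy.le, ← Real.sqrt_mul (by positivity)]
      congr 1
      rw [Real.sqrt_sq hy.le]
      field_simp
    have him : ∀ c : ℝ, 0 < c → Tendsto (fun y : ℝ => Complex.arg ((c : ℂ) + y * Complex.I))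
        atTop (𝓝 (Real.pi / 2)) := by
      intro c hc
      refine (tendsto_arctan_div hc).congr fun y => ?_
      have h1 := abs_lt.mp ((Complex.abs_arg_lt_pi_div_two_iff
        (z := (c : ℂ) + y * Complex.I)).mpr (Or.inl (by simpa using hc)))
      rw [← Real.arctan_tan h1.1 h1.2, Complex.tan_arg]
      simp
    have h1 := ((hre b hb).sub (hre a ha)).ofReal
    have h2 := ((him b hb).sub (him a ha)).ofReal
    have h3 := h1.add (h2.mul_const Complex.I)
    simp only [sub_self, Complex.ofReal_zero, zero_mul, add_zero] at h3
    refine h3.congr fun y => ?_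
    simp only [Complex.log, norm_ofReal_add_mul_I]
    push_cast
    ring
  refine ⟨hi, ?_⟩
  rw [integral_Ioi_of_hasDerivAt_of_tendsto (hd2 0).continuousAt.continuousWithinAt
    (fun y _ => hd2 y) hi ht]
  simp only [Complex.ofReal_zero, zero_mul, add_zero]
  rw [← Complex.ofReal_log hb.le, ← Complex.ofReal_log ha.le]
  push_cast
  ring

/-- The factor $a$ removes the divergence at $a=0$, in accordance with $0\log0=0$; hence $A$ may be
singular. -/
lemma integral_mul_sub_inv_eq_mul_log {a : ℝ} (ha : 0 ≤ a) :
    IntegrableOn (fun y : ℝ => (a : ℂ) * (Complex.I *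
        (((1 : ℝ) + y * Complex.I : ℂ)⁻¹ - ((a : ℂ) + y * Complex.I)⁻¹))) (Set.Ioi 0) ∧
      ∫ y in Set.Ioi (0 : ℝ), (a : ℂ) * (Complex.I *
        (((1 : ℝ) + y * Complex.I : ℂ)⁻¹ - ((a : ℂ) + y * Complex.I)⁻¹)) =
        (a : ℂ) * (Real.log a : ℂ) := by
  rcases ha.eq_or_lt with rfl | ha
  · simp
  · have h := integral_sub_inv_eq_log ha one_pos
    refine ⟨h.1.const_mul _, ?_⟩
    rw [integral_const_mul, h.2]
    simp

lemma integral_sq_mul_inv_sq {b : ℝ} (hb : 0 < b) :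
    IntegrableOn (fun y : ℝ => Complex.I * ((b : ℂ) * ((b : ℂ) + y * Complex.I)⁻¹ * b *
        ((b : ℂ) + y * Complex.I)⁻¹)) (Set.Ioi 0) ∧
      ∫ y in Set.Ioi (0 : ℝ), Complex.I * ((b : ℂ) * ((b : ℂ) + y * Complex.I)⁻¹ * b *
        ((b : ℂ) + y * Complex.I)⁻¹) = b := by
  have hne : ∀ y : ℝ, (b : ℂ) + y * Complex.I ≠ 0 :=
    fun y => ofReal_add_mul_I_ne_zero (Or.inl hb.ne')
  -- The primitive $-b^2/(b+iy)$ equals $-b$ at $0$ and tends to $0$ at infinity.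
  have hd : ∀ y : ℝ, HasDerivAt (fun y : ℝ => -(b : ℂ) ^ 2 * ((b : ℂ) + y * Complex.I)⁻¹)
      (Complex.I * ((b : ℂ) * ((b : ℂ) + y * Complex.I)⁻¹ * b *
        ((b : ℂ) + y * Complex.I)⁻¹)) y := by
    intro y
    have h := ((hasDerivAt_ofReal_add_mul_I b y).fun_inv (hne y)).const_mul (-(b : ℂ) ^ 2)
    refine h.congr_deriv ?_
    rw [div_eq_mul_inv, ← inv_pow]
    ring
  have hcont : Continuous (fun y : ℝ => Complex.I * ((b : ℂ) * ((b : ℂ) + y * Complex.I)⁻¹ * b *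
        ((b : ℂ) + y * Complex.I)⁻¹)) := by
    have : Continuous fun y : ℝ => ((b : ℂ) + y * Complex.I)⁻¹ := Continuous.inv₀ (by fun_prop) hne
    fun_prop
  have hi : IntegrableOn (fun y : ℝ => Complex.I * ((b : ℂ) * ((b : ℂ) + y * Complex.I)⁻¹ * b *
        ((b : ℂ) + y * Complex.I)⁻¹)) (Set.Ioi 0) := by
    refine Integrable.mono' (integral_const_div_sq_add_sq hb (b ^ 2)).1
      hcont.aestronglyMeasurable (ae_of_all _ fun y => le_of_eq ?_)
    simp only [norm_mul, norm_inv, Complex.norm_I, one_mul, norm_ofReal_add_mul_I,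
      Complex.norm_real, Real.norm_eq_abs, abs_of_pos hb]
    have : √(b ^ 2 + y ^ 2) * √(b ^ 2 + y ^ 2) = b ^ 2 + y ^ 2 :=
      Real.mul_self_sqrt (by positivity)
    rw [div_eq_mul_inv]
    conv_rhs => rw [← this, mul_inv]
    ring
  have ht : Tendsto (fun y : ℝ => -(b : ℂ) ^ 2 * ((b : ℂ) + y * Complex.I)⁻¹) atTop (𝓝 0) := by
    rw [tendsto_zero_iff_norm_tendsto_zero]
    refine squeeze_zero' (g := fun y => b ^ 2 / y) (Eventually.of_forall fun _ => norm_nonneg _) ?_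
      (tendsto_const_nhds.div_atTop tendsto_id)
    filter_upwards [eventually_gt_atTop 0] with y hy
    simp only [norm_mul, norm_neg, norm_pow, norm_inv, norm_ofReal_add_mul_I, Complex.norm_real,
      Real.norm_eq_abs, abs_of_pos hb]
    rw [← div_eq_mul_inv]
    refine div_le_div_of_nonneg_left (by positivity) hy ?_
    exact Real.le_sqrt_of_sq_le (by nlinarith)
  refine ⟨hi, ?_⟩
  rw [integral_Ioi_of_hasDerivAt_of_tendsto (hd 0).continuousAt.continuousWithinAt
    (fun y _ => hd y) hi ht]
  have : (b : ℂ) ≠ 0 := by exact_mod_cast hb.ne'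
  simp
  field_simp

end ScalarIntegrals

/-! ### Resolvents of dissipative matrices -/

/-- The resolvent `(M + i y)⁻¹`. -/
def res {n : ℕ} (M : Matrix (Fin n) (Fin n) ℂ) (y : ℝ) : Matrix (Fin n) (Fin n) ℂ :=
  (M + ((y : ℂ) * Complex.I) • 1)⁻¹

section Resolvent

variable {n : ℕ}

lemma qf_add_smul_one (x : Fin n → ℂ) (M : Matrix (Fin n) (Fin n) ℂ) (y : ℝ) :
    qf x (M + ((y : ℂ) * Complex.I) • 1) = qf x M + y * nsq x * Complex.I := by
  rw [qf_add, qf_smul, qf_one]; ring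

/-- `M` has nonnegative imaginary part. -/
def Dissipative (M : Matrix (Fin n) (Fin n) ℂ) : Prop := ∀ x, 0 ≤ (qf x M).im

lemma _root_.Matrix.IsHermitian.dissipative {M : Matrix (Fin n) (Fin n) ℂ} (h : M.IsHermitian) :
    Dissipative M := fun x => (h.qf_im x).ge

lemma Dissipative.isUnit_and_norm_res_le {M : Matrix (Fin n) (Fin n) ℂ} (hM : Dissipative M)
    {y : ℝ} (hy : 0 < y) : IsUnit (M + ((y : ℂ) * Complex.I) • 1) ∧ ‖res M y‖ ≤ y⁻¹ := by
  refine isUnit_and_norm_inv_le hy fun x => ?_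
  rw [qf_add_smul_one]
  refine le_trans ?_ (Complex.abs_im_le_norm _)
  refine le_trans ?_ (le_abs_self _)
  simpa using hM x

/-- In $|q+iy\|x\|^2|^2=|q|^2+2y\|x\|^2\operatorname{Im}q+y^2\|x\|^4$ the cross term is nonnegative
by dissipativity, so the lower bounds for $|q|$ and for $y$ add in squares. -/
lemma Dissipative.isUnit_and_norm_res_le_sqrt {M : Matrix (Fin n) (Fin n) ℂ}
    (hM : Dissipative M) {m : ℝ} (hm : 0 < m) (h : ∀ x, m * nsq x ≤ ‖qf x M‖)
    {y : ℝ} (hy : 0 ≤ y) :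
    IsUnit (M + ((y : ℂ) * Complex.I) • 1) ∧ ‖res M y‖ ≤ (√(m ^ 2 + y ^ 2))⁻¹ := by
  refine isUnit_and_norm_inv_le (by positivity) fun x => ?_
  rw [qf_add_smul_one]
  have h1 := hM x
  have h2 := h x
  have h3 := nsq_nonneg x
  refine Real.le_sqrt_of_sq_le ?_ |>.trans_eq (Complex.norm_def _).symm
  rw [mul_pow, Real.sq_sqrt (by positivity), Complex.normSq_apply]
  have h4 : (m * nsq x) ^ 2 ≤ (qf x M).re ^ 2 + (qf x M).im ^ 2 := by
    have := Complex.sq_norm (qf x M)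
    rw [Complex.normSq_apply] at this
    have h5 : (m * nsq x) ^ 2 ≤ ‖qf x M‖ ^ 2 := by gcongr
    nlinarith
  have h6 : (qf x M + y * nsq x * Complex.I).re = (qf x M).re := by simp
  have h7 : (qf x M + y * nsq x * Complex.I).im = (qf x M).im + y * nsq x := by simp
  rw [h6, h7]
  have : 0 ≤ (qf x M).im * (y * nsq x) := by positivity
  nlinarith

lemma add_mul_res {M : Matrix (Fin n) (Fin n) ℂ} {y : ℝ}
    (h : IsUnit (M + ((y : ℂ) * Complex.I) • 1)) :
    M * res M y = 1 - ((y : ℂ) * Complex.I) • res M y := by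
  have := Matrix.mul_nonsing_inv _ ((Matrix.isUnit_iff_isUnit_det _).mp h)
  rw [Matrix.add_mul, Matrix.smul_mul, Matrix.one_mul] at this
  exact eq_sub_of_add_eq this

lemma res_sub_res {M N : Matrix (Fin n) (Fin n) ℂ} {y : ℝ}
    (hM : IsUnit (M + ((y : ℂ) * Complex.I) • 1)) (hN : IsUnit (N + ((y : ℂ) * Complex.I) • 1)) :
    res M y - res N y = res M y * (N - M) * res N y := by
  have h1 := Matrix.nonsing_inv_mul _ ((Matrix.isUnit_iff_isUnit_det _).mp hM)
  have h2 := Matrix.mul_nonsing_inv _ ((Matrix.isUnit_iff_isUnit_det _).mp hN)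
  have h3 : N - M = (N + ((y : ℂ) * Complex.I) • 1) - (M + ((y : ℂ) * Complex.I) • 1) := by abel
  rw [h3, Matrix.mul_sub, Matrix.sub_mul, res, res, h1, Matrix.one_mul, Matrix.mul_assoc, h2,
    Matrix.mul_one]

lemma continuousAt_matrix_inv {M : Matrix (Fin n) (Fin n) ℂ} (h : IsUnit M) :
    ContinuousAt (fun N : Matrix (Fin n) (Fin n) ℂ => N⁻¹) M := by
  have := (differentiableAt_inverse (𝕜 := ℂ) h).continuousAt
  exact this.congr (Eventually.of_forall fun N => (Matrix.nonsing_inv_eq_ringInverse N).symm)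

lemma differentiableAt_matrix_inv {M : Matrix (Fin n) (Fin n) ℂ} (h : IsUnit M) :
    DifferentiableAt ℂ (fun N : Matrix (Fin n) (Fin n) ℂ => N⁻¹) M := by
  refine (differentiableAt_inverse (𝕜 := ℂ) h).congr_of_eventuallyEq ?_
  exact Eventually.of_forall fun N => Matrix.nonsing_inv_eq_ringInverse N

lemma continuousAt_res {α : Type*} [TopologicalSpace α] {M : α → Matrix (Fin n) (Fin n) ℂ}
    {y : α → ℝ} {a : α} (hM : ContinuousAt M a) (hy : ContinuousAt y a)
    (h : IsUnit (M a + ((y a : ℂ) * Complex.I) • 1)) :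
    ContinuousAt (fun t => res (M t) (y t)) a := by
  have h1 : ContinuousAt (fun t => M t + ((y t : ℂ) * Complex.I) • (1 : Matrix (Fin n) (Fin n) ℂ)) a :=
    hM.add (((Complex.continuous_ofReal.continuousAt.comp hy).mul continuousAt_const).smul
      continuousAt_const)
  exact ContinuousAt.comp (g := fun N : Matrix (Fin n) (Fin n) ℂ => N⁻¹)
    (continuousAt_matrix_inv h) h1

lemma res_eq_spec {X : Matrix (Fin n) (Fin n) ℂ} (hX : X.IsHermitian) {y : ℝ}
    (h : y ≠ 0 ∨ ∀ j, hX.eigenvalues j ≠ 0) :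
    res X y = spec hX (fun a => ((a : ℂ) + y * Complex.I)⁻¹) := by
  have h1 : X + ((y : ℂ) * Complex.I) • 1 = spec hX (fun a => (a : ℂ) + y * Complex.I) := by
    rw [← spec_add, spec_ofReal, spec_const]
  rw [res, h1, inv_spec]
  exact fun j => ofReal_add_mul_I_ne_zero (h.symm.imp (fun h => h j) id)

lemma exists_pos_le_qf {B : Matrix (Fin n) (Fin n) ℂ} (hB : B.PosDef) :
    ∃ b : ℝ, 0 < b ∧ ∀ x, b * nsq x ≤ (qf x B).re := by
  have hev : ∀ j, 0 < hB.isHermitian.eigenvalues j := hB.eigenvalues_pos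
  obtain ⟨b, hb, hle⟩ : ∃ b : ℝ, 0 < b ∧ ∀ j, b ≤ hB.isHermitian.eigenvalues j := by
    rcases isEmpty_or_nonempty (Fin n) with h | h
    · exact ⟨1, one_pos, fun j => h.elim j⟩
    · obtain ⟨j, hj⟩ := Finite.exists_min hB.isHermitian.eigenvalues
      exact ⟨_, hev j, hj⟩
  refine ⟨b, hb, fun x => ?_⟩
  have h := qf_spec hB.isHermitian x (fun a => (a : ℂ))
  rw [spec_ofReal] at h
  have h2 : (qf x B).re = ∑ j, hB.isHermitian.eigenvalues j * ‖coord hB.isHermitian x j‖ ^ 2 := by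
    rw [h, Complex.re_sum]
    exact Finset.sum_congr rfl fun j _ => by norm_cast
  rw [h2, ← nsq_coord hB.isHermitian, nsq, Finset.mul_sum]
  exact Finset.sum_le_sum fun j _ => mul_le_mul_of_nonneg_right (hle j) (by positivity)

lemma isUnit_and_norm_res_le_of_le {M : Matrix (Fin n) (Fin n) ℂ} (hM : M.IsHermitian) {m : ℝ}
    (hm : 0 < m) (h : ∀ x, m * nsq x ≤ (qf x M).re) {y : ℝ} (hy : 0 ≤ y) :
    IsUnit (M + ((y : ℂ) * Complex.I) • 1) ∧ ‖res M y‖ ≤ (√(m ^ 2 + y ^ 2))⁻¹ :=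
  hM.dissipative.isUnit_and_norm_res_le_sqrt hm
    (fun x => (h x).trans ((le_abs_self _).trans (Complex.abs_re_le_norm _))) hy

lemma posDef_of_le {M : Matrix (Fin n) (Fin n) ℂ} (hM : M.IsHermitian) {m : ℝ}
    (hm : 0 < m) (h : ∀ x, m * nsq x ≤ (qf x M).re) : M.PosDef :=
  Matrix.posDef_iff_dotProduct_mulVec.mpr ⟨hM, fun x hx => by
    change 0 < qf x M
    rw [hM.qf_eq_re]
    exact_mod_cast (mul_pos hm (nsq_pos hx)).trans_le (h x)⟩

end Resolvent

/-! ### The matrix logarithm and its derivative -/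

section Log

variable {n : ℕ}

lemma log_eq_spec {X : Matrix (Fin n) (Fin n) ℂ} (hX : X.IsHermitian) :
    CFC.log X = spec hX (fun a => (Real.log a : ℂ)) := cfc_eq_spec hX _

lemma res_one_eq_spec {X : Matrix (Fin n) (Fin n) ℂ} (hX : X.IsHermitian) (y : ℝ) :
    res 1 y = spec hX (fun _ => ((1 : ℝ) + y * Complex.I : ℂ)⁻¹) := by
  have h1 : (1 : Matrix (Fin n) (Fin n) ℂ) + ((y : ℂ) * Complex.I) • 1 =
      spec hX (fun _ => (1 : ℝ) + y * Complex.I) := by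
    rw [spec_const, add_smul]; simp
  rw [res, h1, inv_spec]
  exact fun j => ofReal_add_mul_I_ne_zero (Or.inl one_ne_zero)

/-- Subtracting the resolvent of the identity makes the integral converge, and costs nothing because
$\log1=0$. -/
lemma integral_res_one_sub_res {X : Matrix (Fin n) (Fin n) ℂ} (hX : X.PosDef) :
    IntegrableOn (fun y => Complex.I • (res 1 y - res X y)) (Set.Ioi 0) ∧
      ∫ y in Set.Ioi (0 : ℝ), Complex.I • (res 1 y - res X y) = CFC.log X := by
  have he : ∀ y : ℝ, Complex.I • (res 1 y - res X y) = spec hX.isHermitian (fun a => Complex.I *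
        (((1 : ℝ) + y * Complex.I : ℂ)⁻¹ - ((a : ℂ) + y * Complex.I)⁻¹)) := by
    intro y
    rw [res_one_eq_spec hX.isHermitian,
      res_eq_spec hX.isHermitian (Or.inr fun j => (hX.eigenvalues_pos j).ne'), ← spec_smul]
    congr 1
    rw [sub_eq_add_neg, ← neg_one_smul ℂ, spec_smul, spec_add]
    congr; ext a; ring
  simp only [he, log_eq_spec hX.isHermitian]
  refine integral_spec hX.isHermitian (fun j => ?_) (fun j => ?_)
  · exact (integral_sub_inv_eq_log (hX.eigenvalues_pos j) one_pos).1
  · rw [(integral_sub_inv_eq_log (hX.eigenvalues_pos j) one_pos).2, Real.log_one, sub_zero]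

lemma integral_mul_res_one_sub_res {A : Matrix (Fin n) (Fin n) ℂ} (hA : A.PosSemidef) :
    IntegrableOn (fun y => A * (Complex.I • (res 1 y - res A y))) (Set.Ioi 0) ∧
      ∫ y in Set.Ioi (0 : ℝ), A * (Complex.I • (res 1 y - res A y)) = A * CFC.log A := by
  have he : ∀ y ∈ Set.Ioi (0 : ℝ), A * (Complex.I • (res 1 y - res A y)) =
      spec hA.isHermitian (fun a => (a : ℂ) * (Complex.I *
        (((1 : ℝ) + y * Complex.I : ℂ)⁻¹ - ((a : ℂ) + y * Complex.I)⁻¹))) := by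
    intro y hy
    rw [res_one_eq_spec hA.isHermitian,
      res_eq_spec hA.isHermitian (Or.inl (ne_of_gt hy)), ← spec_mul, spec_ofReal, ← spec_smul]
    congr 2
    rw [sub_eq_add_neg, ← neg_one_smul ℂ, spec_smul, spec_add]
    congr; ext a; ring
  have h := integral_spec hA.isHermitian (s := Set.Ioi 0) (f := fun y a => (a : ℂ) * (Complex.I *
        (((1 : ℝ) + y * Complex.I : ℂ)⁻¹ - ((a : ℂ) + y * Complex.I)⁻¹)))
    (F := fun a => (a : ℂ) * (Real.log a : ℂ))
    (fun j => (integral_mul_sub_inv_eq_mul_log (hA.eigenvalues_nonneg j)).1)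
    (fun j => (integral_mul_sub_inv_eq_mul_log (hA.eigenvalues_nonneg j)).2)
  refine ⟨h.1.congr_fun (fun y hy => (he y hy).symm) measurableSet_Ioi, ?_⟩
  rw [setIntegral_congr_fun measurableSet_Ioi he, h.2, ← spec_mul, spec_ofReal, log_eq_spec]

lemma integral_mul_res_mul_res {B : Matrix (Fin n) (Fin n) ℂ} (hB : B.PosDef) :
    IntegrableOn (fun y => Complex.I • (B * res B y * B * res B y)) (Set.Ioi 0) ∧
      ∫ y in Set.Ioi (0 : ℝ), Complex.I • (B * res B y * B * res B y) = B := by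
  have he : ∀ y : ℝ, Complex.I • (B * res B y * B * res B y) =
      spec hB.isHermitian (fun b => Complex.I * ((b : ℂ) * ((b : ℂ) + y * Complex.I)⁻¹ * b *
        ((b : ℂ) + y * Complex.I)⁻¹)) := by
    intro y
    rw [res_eq_spec hB.isHermitian (Or.inr fun j => (hB.eigenvalues_pos j).ne'), ← spec_smul,
      ← spec_mul, ← spec_mul, ← spec_mul, spec_ofReal]
  simp only [he]
  have h := integral_spec hB.isHermitian (s := Set.Ioi 0) (f := fun y b => Complex.I *
        ((b : ℂ) * ((b : ℂ) + y * Complex.I)⁻¹ * b * ((b : ℂ) + y * Complex.I)⁻¹))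
    (F := fun b => (b : ℂ))
    (fun j => (integral_sq_mul_inv_sq (hB.eigenvalues_pos j)).1)
    (fun j => (integral_sq_mul_inv_sq (hB.eigenvalues_pos j)).2)
  rwa [spec_ofReal] at h

/-- In the difference of two logarithms the resolvents of the identity cancel, and the resolvent
identity leaves a factor $X-B$; with $X=B+tA$ the difference quotient can be read off. -/
lemma integral_res_mul_sub_mul_res {B X : Matrix (Fin n) (Fin n) ℂ} (hB : B.PosDef)
    (hX : X.PosDef) :
    IntegrableOn (fun y => Complex.I • (res B y * (X - B) * res X y)) (Set.Ioi 0) ∧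
      ∫ y in Set.Ioi (0 : ℝ), Complex.I • (res B y * (X - B) * res X y) =
        CFC.log X - CFC.log B := by
  have h1 := integral_res_one_sub_res hX
  have h2 := integral_res_one_sub_res hB
  have he : ∀ y ∈ Set.Ioi (0 : ℝ), Complex.I • (res 1 y - res X y) -
      Complex.I • (res 1 y - res B y) = Complex.I • (res B y * (X - B) * res X y) := by
    intro y hy
    rw [← res_sub_res (hB.isHermitian.dissipative.isUnit_and_norm_res_le hy).1
      (hX.isHermitian.dissipative.isUnit_and_norm_res_le hy).1, ← smul_sub]
    congr 1; abel
  refine ⟨(h1.1.sub h2.1).congr_fun (fun y hy => he y hy) measurableSet_Ioi, ?_⟩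
  rw [← h1.2, ← h2.2, ← integral_sub h1.1 h2.1]
  exact (setIntegral_congr_fun measurableSet_Ioi he).symm

/-- The derivative of the matrix logarithm at a positive definite matrix. -/
theorem hasLineDerivAt_log {A B : Matrix (Fin n) (Fin n) ℂ} (hA : A.IsHermitian) (hB : B.PosDef) :
    IntegrableOn (fun y => Complex.I • (res B y * A * res B y)) (Set.Ioi 0) ∧
      HasLineDerivAt ℝ CFC.log (∫ y in Set.Ioi (0 : ℝ), Complex.I • (res B y * A * res B y)) B A := by
  obtain ⟨b, hb, hle⟩ := exists_pos_le_qf hB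
  have hb2 : 0 < b / 2 := by positivity
  have hherm : ∀ t : ℝ, (B + t • A).IsHermitian := fun t =>
    hB.isHermitian.add (hA.smul (IsSelfAdjoint.all t))
  -- A perturbation of norm at most $b/2$ costs at most half of the lower bound $b$ of $B$. This
  -- makes the dominating function below uniform in $t$.
  have hnear : ∀ᶠ t : ℝ in 𝓝 0, ∀ x, b / 2 * nsq x ≤ (qf x (B + t • A)).re := by
    have hc : Tendsto (fun t : ℝ => |t| * ‖A‖) (𝓝 0) (𝓝 0) := by
      have : Continuous fun t : ℝ => |t| * ‖A‖ := by fun_prop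
      simpa using this.tendsto 0
    filter_upwards [hc.eventually (ge_mem_nhds hb2)] with t ht x
    have h1 := hle x
    have h2 := (Complex.abs_re_le_norm _).trans (norm_qf_le x (t • A))
    rw [norm_smul, Real.norm_eq_abs] at h2
    have h3 := (abs_le.mp h2).1
    rw [qf_add, Complex.add_re]
    nlinarith [nsq_nonneg x]
  have hBle : ∀ x, b / 2 * nsq x ≤ (qf x B).re := fun x =>
    (mul_le_mul_of_nonneg_right (half_le_self hb.le) (nsq_nonneg x)).trans (hle x)
  have hbound : ∀ t : ℝ, (∀ x, b / 2 * nsq x ≤ (qf x (B + t • A)).re) → ∀ y ∈ Set.Ioi (0 : ℝ),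
      ‖Complex.I • (res B y * A * res (B + t • A) y)‖ ≤ ‖A‖ / ((b / 2) ^ 2 + y ^ 2) := by
    intro t ht y hy
    have h1 := (isUnit_and_norm_res_le_of_le hB.isHermitian hb2 hBle (le_of_lt hy)).2
    have h2 := (isUnit_and_norm_res_le_of_le (hherm t) hb2 ht (le_of_lt hy)).2
    rw [norm_smul, Complex.norm_I, one_mul]
    have hs : √((b / 2) ^ 2 + y ^ 2) * √((b / 2) ^ 2 + y ^ 2) = (b / 2) ^ 2 + y ^ 2 :=
      Real.mul_self_sqrt (by positivity)
    calc ‖res B y * A * res (B + t • A) y‖ ≤ ‖res B y‖ * ‖A‖ * ‖res (B + t • A) y‖ :=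
          (norm_mul_le _ _).trans (mul_le_mul_of_nonneg_right (norm_mul_le _ _) (norm_nonneg _))
      _ ≤ (√((b / 2) ^ 2 + y ^ 2))⁻¹ * ‖A‖ * (√((b / 2) ^ 2 + y ^ 2))⁻¹ := by gcongr
      _ = ‖A‖ / ((b / 2) ^ 2 + y ^ 2) := by
        rw [div_eq_mul_inv ‖A‖]
        conv_rhs => rw [← hs, mul_inv]
        ring
  have hcont : ∀ t : ℝ, ContinuousOn (fun y => Complex.I • (res B y * A * res (B + t • A) y))
      (Set.Ioi 0) := by
    intro t y hy
    refine ContinuousAt.continuousWithinAt ?_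
    have h1 := continuousAt_res (M := fun _ : ℝ => B) (y := id) (a := y) continuousAt_const
      continuousAt_id (hB.isHermitian.dissipative.isUnit_and_norm_res_le hy).1
    have h2 := continuousAt_res (M := fun _ : ℝ => B + t • A) (y := id) (a := y) continuousAt_const
      continuousAt_id ((hherm t).dissipative.isUnit_and_norm_res_le hy).1
    have h3 : ContinuousAt (fun y => res B y * A * res (B + t • A) y) y :=
      (h1.mul continuousAt_const).mul h2
    exact h3.const_smul Complex.I
  have hbi := (integral_const_div_sq_add_sq hb2 ‖A‖).1
  have hint0 : IntegrableOn (fun y => Complex.I • (res B y * A * res B y)) (Set.Ioi 0) := by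
    have hc := hcont 0
    have hb0 := hbound 0 (by simpa using hBle)
    simp only [zero_smul, add_zero] at hc hb0
    exact hbi.mono' (hc.aestronglyMeasurable measurableSet_Ioi)
      ((ae_restrict_mem measurableSet_Ioi).mono hb0)
  refine ⟨hint0, ?_⟩
  rw [HasLineDerivAt, hasDerivAt_iff_tendsto_slope]
  have hlim : Tendsto (fun t : ℝ => ∫ y in Set.Ioi (0 : ℝ),
      Complex.I • (res B y * A * res (B + t • A) y)) (𝓝 0)
      (𝓝 (∫ y in Set.Ioi (0 : ℝ), Complex.I • (res B y * A * res B y))) := by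
    refine tendsto_integral_filter_of_dominated_convergence _ ?_ ?_ hbi ?_
    · exact Eventually.of_forall fun t => (hcont t).aestronglyMeasurable measurableSet_Ioi
    · filter_upwards [hnear] with t ht
      exact (ae_restrict_mem measurableSet_Ioi).mono (hbound t ht)
    · filter_upwards [ae_restrict_mem measurableSet_Ioi] with y hy
      have h2 := continuousAt_res (M := fun t : ℝ => B + t • A) (y := fun _ => y) (a := 0)
        (by fun_prop) continuousAt_const ((hherm 0).dissipative.isUnit_and_norm_res_le hy).1
      have h3 : ContinuousAt (fun t : ℝ => res B y * A * res (B + t • A) y) 0 :=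
        continuousAt_const.mul h2
      have h4 := (h3.const_smul Complex.I).tendsto
      rw [Pi.smul_apply, zero_smul, add_zero] at h4
      exact h4
  refine (hlim.mono_left nhdsWithin_le_nhds).congr' ?_
  filter_upwards [nhdsWithin_le_nhds hnear, self_mem_nhdsWithin] with t ht ht0
  have ht0' : t ≠ 0 := ht0
  rw [slope_def_module, zero_smul, add_zero, sub_zero,
    ← (integral_res_mul_sub_mul_res hB (posDef_of_le (hherm t) hb2 ht)).2, ← integral_smul]
  refine setIntegral_congr_fun measurableSet_Ioi fun y _ => ?_
  simp only [add_sub_cancel_left]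
  rw [Matrix.mul_smul, Matrix.smul_mul, smul_comm Complex.I, smul_smul, inv_mul_cancel₀ ht0',
    one_smul]

end Log

/-! ### The holomorphic kernel and its contour integral -/

/-- The kernel whose integral over `y > 0` at `E = 0` is `Δ(A‖B)`; it is holomorphic in `E` on the
closed upper half plane. -/
def psi {n : ℕ} (A B : Matrix (Fin n) (Fin n) ℂ) (E : ℂ) (y : ℝ) : Matrix (Fin n) (Fin n) ℂ :=
  -((y : ℂ) • (res ((1 + E) • B) y * (A - B) * res (A + E • B) y * (A - B) * res ((1 + E) • B) y))

section Kernel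

variable {n : ℕ} {A B : Matrix (Fin n) (Fin n) ℂ}

lemma _root_.Matrix.PosSemidef.dissipative_smul (hB : B.PosSemidef) {E : ℂ} (hE : 0 ≤ E.im) :
    Dissipative (E • B) := fun x => by
  rw [qf_smul, hB.isHermitian.qf_eq_re, Complex.mul_im]
  simpa using mul_nonneg hE (hB.qf_re x)

lemma dissipative_add_smul (hA : A.IsHermitian) (hB : B.PosSemidef) {E : ℂ} (hE : 0 ≤ E.im) :
    Dissipative (A + E • B) := fun x => by
  rw [qf_add, Complex.add_im]
  exact add_nonneg (hA.dissipative x) (hB.dissipative_smul hE x)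

lemma dissipative_one_add_smul (hB : B.PosSemidef) {E : ℂ} (hE : 0 ≤ E.im) :
    Dissipative ((1 + E) • B) := hB.dissipative_smul (by simpa using hE)

/-- The resolvent identity used twice: the left side is the remainder of the first-order expansion
of the resolvent of $X$ about $Y$. -/
lemma res_mul_sub_mul_res_mul {Y X C : Matrix (Fin n) (Fin n) ℂ} {y : ℝ} (hC : X - Y = C)
    (hX : IsUnit (X + ((y : ℂ) * Complex.I) • 1)) (hY : IsUnit (Y + ((y : ℂ) * Complex.I) • 1)) :
    res Y y * C * res X y * C * res Y y = res X y - res Y y + res Y y * C * res Y y := by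
  have h1 := res_sub_res hY hX
  have h2 := res_sub_res hX hY
  rw [← neg_sub X Y, hC] at h2
  rw [hC] at h1
  rw [← h1, Matrix.sub_mul, Matrix.sub_mul]
  rw [Matrix.mul_neg, Matrix.neg_mul] at h2
  rw [show res X y * C * res Y y = -(res X y - res Y y) by rw [h2, neg_neg]]
  abel

lemma psi_eq (hA : A.IsHermitian) (hB : B.PosSemidef) {E : ℂ} (hE : 0 ≤ E.im) {y : ℝ}
    (hy : 0 < y) :
    psi A B E y = -((y : ℂ) • res (A + E • B) y) + (y : ℂ) • res ((1 + E) • B) y -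
      (y : ℂ) • (res ((1 + E) • B) y * (A - B) * res ((1 + E) • B) y) := by
  rw [psi, res_mul_sub_mul_res_mul (by rw [add_smul, one_smul]; abel)
    ((dissipative_add_smul hA hB hE).isUnit_and_norm_res_le hy).1
    ((dissipative_one_add_smul hB hE).isUnit_and_norm_res_le hy).1, smul_add, smul_sub]
  abel

/-- The middle resolvent is at most $1/y$, which absorbs the factor $y$, and each outer one is at
most $((db)^2+y^2)^{-1/2}$. The bound is integrable in $y$, and uniform in $E$ as long as $E$ stays
at distance at least $d$ from $-1$. -/
lemma norm_psi_le (hA : A.IsHermitian) (hB : B.PosSemidef) {b : ℝ} (hb : 0 < b)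
    (hle : ∀ x, b * nsq x ≤ (qf x B).re) {E : ℂ} (hE : 0 ≤ E.im) {d : ℝ} (hd : 0 < d)
    (hdE : d ≤ ‖1 + E‖) {y : ℝ} (hy : 0 < y) :
    ‖psi A B E y‖ ≤ ‖A - B‖ ^ 2 / ((d * b) ^ 2 + y ^ 2) := by
  have h1 := ((dissipative_add_smul hA hB hE).isUnit_and_norm_res_le hy).2
  have h2 := ((dissipative_one_add_smul hB hE).isUnit_and_norm_res_le_sqrt (mul_pos hd hb)
    (fun x => by
      rw [qf_smul, norm_mul, mul_assoc]
      exact mul_le_mul hdE ((hle x).trans ((le_abs_self _).trans (Complex.abs_re_le_norm _)))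
        (mul_nonneg hb.le (nsq_nonneg x)) (norm_nonneg _)) hy.le).2
  have hs : √((d * b) ^ 2 + y ^ 2) * √((d * b) ^ 2 + y ^ 2) = (d * b) ^ 2 + y ^ 2 :=
    Real.mul_self_sqrt (by positivity)
  rw [psi, norm_neg, norm_smul, Complex.norm_real, Real.norm_eq_abs, abs_of_pos hy]
  set R := res ((1 + E) • B) y
  set Q := res (A + E • B) y
  calc y * ‖R * (A - B) * Q * (A - B) * R‖
      ≤ y * (‖R‖ * ‖A - B‖ * ‖Q‖ * ‖A - B‖ * ‖R‖) := by
        refine mul_le_mul_of_nonneg_left ?_ hy.le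
        refine (norm_mul_le _ _).trans (mul_le_mul_of_nonneg_right ?_ (norm_nonneg _))
        refine (norm_mul_le _ _).trans (mul_le_mul_of_nonneg_right ?_ (norm_nonneg _))
        refine (norm_mul_le _ _).trans (mul_le_mul_of_nonneg_right ?_ (norm_nonneg _))
        exact norm_mul_le _ _
    _ ≤ y * ((√((d * b) ^ 2 + y ^ 2))⁻¹ * ‖A - B‖ * y⁻¹ * ‖A - B‖ *
          (√((d * b) ^ 2 + y ^ 2))⁻¹) := by gcongr
    _ = y * y⁻¹ * (‖A - B‖ ^ 2 * ((√((d * b) ^ 2 + y ^ 2))⁻¹ *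
          (√((d * b) ^ 2 + y ^ 2))⁻¹)) := by ring
    _ = ‖A - B‖ ^ 2 / ((d * b) ^ 2 + y ^ 2) := by
        rw [← mul_inv, hs, mul_inv_cancel₀ hy.ne', one_mul, ← div_eq_mul_inv]

lemma differentiableAt_res {M : ℂ → Matrix (Fin n) (Fin n) ℂ} {E : ℂ} {y : ℝ}
    (hM : DifferentiableAt ℂ M E) (h : IsUnit (M E + ((y : ℂ) * Complex.I) • 1)) :
    DifferentiableAt ℂ (fun E => res (M E) y) E :=
  DifferentiableAt.comp (g := fun N : Matrix (Fin n) (Fin n) ℂ => N⁻¹) E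
    (differentiableAt_matrix_inv h) (hM.add_const _)

lemma differentiableAt_psi (hA : A.IsHermitian) (hB : B.PosSemidef) {E : ℂ} (hE : 0 ≤ E.im)
    {y : ℝ} (hy : 0 < y) : DifferentiableAt ℂ (fun E => psi A B E y) E := by
  have h1 : DifferentiableAt ℂ (fun E => res (A + E • B) y) E :=
    differentiableAt_res (by fun_prop)
      ((dissipative_add_smul hA hB hE).isUnit_and_norm_res_le hy).1
  have h2 : DifferentiableAt ℂ (fun E => res ((1 + E) • B) y) E :=
    differentiableAt_res (by fun_prop)
      ((dissipative_one_add_smul hB hE).isUnit_and_norm_res_le hy).1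
  have h3 : DifferentiableAt ℂ (fun E => res ((1 + E) • B) y * (A - B) * res (A + E • B) y *
      (A - B) * res ((1 + E) • B) y) E :=
    (((h2.mul_const _).mul h1).mul_const _).mul h2
  exact (h3.const_smul (y : ℂ)).neg

lemma continuousAt_psi (hA : A.IsHermitian) (hB : B.PosSemidef) {α : Type*} [TopologicalSpace α]
    {E : α → ℂ} {y : α → ℝ} {a : α} (hE : ContinuousAt E a) (hy : ContinuousAt y a)
    (hE0 : 0 ≤ (E a).im) (hy0 : 0 < y a) : ContinuousAt (fun t => psi A B (E t) (y t)) a := by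
  have h1 : ContinuousAt (fun t => res (A + E t • B) (y t)) a :=
    continuousAt_res (by fun_prop) hy
      ((dissipative_add_smul hA hB hE0).isUnit_and_norm_res_le hy0).1
  have h2 : ContinuousAt (fun t => res ((1 + E t) • B) (y t)) a :=
    continuousAt_res (by fun_prop) hy
      ((dissipative_one_add_smul hB hE0).isUnit_and_norm_res_le hy0).1
  have h3 : ContinuousAt (fun t => res ((1 + E t) • B) (y t) * (A - B) * res (A + E t • B) (y t) *
      (A - B) * res ((1 + E t) • B) (y t)) a :=
    (((h2.mul continuousAt_const).mul h1).mul continuousAt_const).mul h2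
  exact ((Complex.continuous_ofReal.continuousAt.comp hy).smul h3).neg

/-- The divergence operator as an integral of resolvents. -/
theorem integral_psi_zero (hA : A.PosSemidef) (hB : B.PosDef) :
    IntegrableOn (psi A B 0) (Set.Ioi 0) ∧ ∫ y in Set.Ioi (0 : ℝ), psi A B 0 y = Δ A B := by
  have hD := hasLineDerivAt_log hA.isHermitian hB
  have h1 := integral_mul_res_one_sub_res hA
  have h2 := integral_res_one_sub_res hB
  have h3 := integral_mul_res_mul_res hB
  have i2 := h2.1.const_mul A
  have iD := hD.1.const_mul B
  -- The four terms represent $A\log A$, $A\log B$, $B\,D\log[B](A)$ and $B$. They combine to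
  -- $i(AR_A-BR_B)(A-B)R_B$. Here $AR_A-BR_B=iy(R_B-R_A)=iy\,R_B(A-B)R_A$, and $i\cdot iy=-y$.
  have he : ∀ y ∈ Set.Ioi (0 : ℝ), A * (Complex.I • (res 1 y - res A y)) -
      A * (Complex.I • (res 1 y - res B y)) - B * (Complex.I • (res B y * A * res B y)) +
      Complex.I • (B * res B y * B * res B y) = psi A B 0 y := by
    intro y hy
    have uA := (hA.isHermitian.dissipative.isUnit_and_norm_res_le hy).1
    have uB := (hB.isHermitian.dissipative.isUnit_and_norm_res_le hy).1
    have e1 := add_mul_res uA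
    have e2 := add_mul_res uB
    have e3 := res_sub_res uA uB
    have e4 := res_sub_res uB uA
    simp only [psi, zero_smul, add_zero, one_smul]
    set RA := res A y
    set RB := res B y
    have k1 : A * RB - A * RA = (A * RA) * (A - B) * RB := by
      rw [← Matrix.mul_sub, Matrix.mul_assoc, Matrix.mul_assoc, ← Matrix.mul_assoc RA,
        ← neg_sub B A, Matrix.mul_neg, Matrix.neg_mul, ← e3, neg_sub]
    have k2 : A * (Complex.I • (res 1 y - RA)) - A * (Complex.I • (res 1 y - RB)) =
        Complex.I • (A * RB - A * RA) := by
      rw [← Matrix.mul_sub, ← smul_sub, Matrix.mul_smul, ← Matrix.mul_sub]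
      congr 2; abel
    have k3 : B * (Complex.I • (RB * A * RB)) = Complex.I • (B * RB * A * RB) := by
      rw [Matrix.mul_smul]; simp only [Matrix.mul_assoc]
    rw [k2, k1, k3, e1, sub_add, ← smul_sub, ← Matrix.sub_mul, ← Matrix.mul_sub, e2, ← smul_sub,
      ← Matrix.sub_mul, ← Matrix.sub_mul]
    have k4 : (1 - ((y : ℂ) * Complex.I) • RA) - (1 - ((y : ℂ) * Complex.I) • RB) =
        ((y : ℂ) * Complex.I) • (RB * (A - B) * RA) := by
      rw [← e4, smul_sub]; abel
    rw [k4, Matrix.smul_mul, Matrix.smul_mul, smul_smul, ← neg_smul]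
    congr 1
    linear_combination (y : ℂ) * Complex.I_mul_I
  have i3 : IntegrableOn (fun y => A * (Complex.I • (res 1 y - res A y)) -
      A * (Complex.I • (res 1 y - res B y))) (Set.Ioi 0) := h1.1.sub i2
  have i4 : IntegrableOn (fun y => A * (Complex.I • (res 1 y - res A y)) -
      A * (Complex.I • (res 1 y - res B y)) - B * (Complex.I • (res B y * A * res B y)))
      (Set.Ioi 0) := i3.sub iD
  refine ⟨IntegrableOn.congr_fun (i4.add h3.1) (fun y hy => he y hy) measurableSet_Ioi, ?_⟩
  rw [← setIntegral_congr_fun measurableSet_Ioi he,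
    integral_add i4 h3.1, integral_sub i3 iD, integral_sub h1.1 i2, h1.2, h3.2, integral_const_mul_of_integrable h2.1,
    integral_const_mul_of_integrable hD.1, h2.2, Δ, Dlog, hD.2.lineDeriv, Matrix.mul_sub]

/-- The integral of the kernel over a half circle of radius `exp r`. -/
def arc (A B : Matrix (Fin n) (Fin n) ℂ) (x : Fin n → ℂ) (r y : ℝ) : ℂ :=
  ∫ θ in (0 : ℝ)..Real.pi, qf x (psi A B (Complex.exp (r + θ * Complex.I)) y)

lemma exp_add_mul_I_im_nonneg (r : ℝ) {θ : ℝ} (hθ : θ ∈ Set.Icc 0 Real.pi) :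
    0 ≤ (Complex.exp (r + θ * Complex.I)).im := by
  rw [Complex.exp_im]
  simpa using mul_nonneg (Real.exp_pos r).le (Real.sin_nonneg_of_mem_Icc hθ)

/-- Cauchy's theorem for $\psi\,dE/E$ on the half annulus $e^{-S}\le|E|\le e^S$,
$\operatorname{Im}E\ge0$. The substitution $E=e^w$ turns it into a rectangle and removes the weight
$1/E$; the edges at heights $0$ and $\pi$ become the positive and the negative real axis. -/
theorem contour_psi (hA : A.IsHermitian) (hB : B.PosSemidef) (x : Fin n → ℂ) (S : ℝ) {y : ℝ}
    (hy : 0 < y) :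
    (∫ s in (-S)..S, qf x (psi A B (Real.exp s : ℝ) y)) -
      (∫ s in (-S)..S, qf x (psi A B (-Real.exp s : ℝ) y)) +
      Complex.I * arc A B x S y - Complex.I * arc A B x (-S) y = 0 := by
  have hd : DifferentiableOn ℂ (fun w => qf x (psi A B (Complex.exp w) y))
      (Set.uIcc (-S) S ×ℂ Set.uIcc 0 Real.pi) := by
    intro w hw
    have him : w.im ∈ Set.Icc 0 Real.pi := by
      have := hw.2
      simpa [Set.uIcc_of_le Real.pi_pos.le] using this
    have h1 : 0 ≤ (Complex.exp w).im := by
      have := exp_add_mul_I_im_nonneg w.re him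
      rwa [Complex.re_add_im] at this
    refine DifferentiableAt.differentiableWithinAt ?_
    have h2 : DifferentiableAt ℂ (fun w => psi A B (Complex.exp w) y) w :=
      DifferentiableAt.comp (g := fun E => psi A B E y) w (differentiableAt_psi hA hB h1 hy)
        Complex.differentiable_exp.differentiableAt
    exact (qfCLM x).differentiableAt.comp w h2
  have h := Complex.integral_boundary_rect_eq_zero_of_differentiableOn _ (⟨-S, 0⟩ : ℂ) ⟨S, Real.pi⟩ hd
  have e1 : ∀ s : ℝ, Complex.exp (s + (0 : ℝ) * Complex.I) = (Real.exp s : ℝ) := fun s => by simp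
  have e2 : ∀ s : ℝ, Complex.exp (s + Real.pi * Complex.I) = (-Real.exp s : ℝ) := fun s => by
    rw [Complex.exp_add, Complex.exp_pi_mul_I]; simp
  simp only [e1, e2, smul_eq_mul] at h
  exact h

end Kernel

/-! ### Positive parts -/

section PosPart

variable {n : ℕ} {X : Matrix (Fin n) (Fin n) ℂ}

lemma posPart_eq_spec (hX : X.IsHermitian) :
    posPart X = spec hX (fun a => ((max a 0 : ℝ) : ℂ)) := by
  rw [posPart, posProj, cfc_eq_spec hX]
  nth_rewrite 1 [← spec_ofReal hX]
  rw [spec_mul]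
  refine spec_congr hX fun j => ?_
  split_ifs with h
  · rw [max_eq_left h.le]; simp
  · rw [max_eq_right (not_lt.mp h)]; simp

lemma posPart_eq_cfc (hX : X.IsHermitian) : posPart X = cfc (fun a : ℝ => max a 0) X := by
  rw [posPart_eq_spec hX, cfc_eq_spec hX]

lemma spec_abs_add (hX : X.IsHermitian) :
    spec hX (fun a => ((|a| : ℝ) : ℂ)) = (2 : ℂ) • posPart X - X := by
  rw [posPart_eq_spec hX, spec_smul, sub_eq_add_neg, ← neg_one_smul ℂ X]
  conv_rhs => enter [2, 2]; rw [← spec_ofReal hX]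
  rw [spec_smul, spec_add]
  refine spec_congr hX fun j => ?_
  rcases le_total 0 (hX.eigenvalues j) with h | h
  · rw [abs_of_nonneg h, max_eq_left h]; ring
  · rw [abs_of_nonpos h, max_eq_right h]; simp

lemma qf_spec_nonneg (hX : X.IsHermitian) {f : ℝ → ℝ} (hf : ∀ j, 0 ≤ f (hX.eigenvalues j)) :
    (spec hX (fun a => (f a : ℂ))).PosSemidef := by
  rw [posSemidef_iff_qf]
  intro x
  have : qf x (spec hX (fun a => (f a : ℂ))) =
      ((∑ j, f (hX.eigenvalues j) * ‖coord hX x j‖ ^ 2 : ℝ) : ℂ) := by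
    rw [qf_spec]; push_cast; rfl
  rw [this, Complex.ofReal_re, Complex.ofReal_im]
  exact ⟨Finset.sum_nonneg fun j _ => mul_nonneg (hf j) (by positivity), rfl⟩

lemma posSemidef_posPart (hX : X.IsHermitian) : (posPart X).PosSemidef := by
  rw [posPart_eq_spec hX]
  exact qf_spec_nonneg hX fun j => le_max_right _ _

lemma posPart_neg (hX : X.IsHermitian) : posPart (-X) = posPart X - X := by
  have hX' : IsSelfAdjoint X := hX
  rw [posPart_eq_cfc hX.neg, posPart_eq_cfc hX, ← cfc_comp_neg (R := ℝ) (fun a => max a 0) X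
    ((Matrix.finite_real_spectrum.image _).continuousOn _), cfc_eq_spec hX, cfc_eq_spec hX]
  conv_rhs => enter [2]; rw [← spec_ofReal hX]
  rw [sub_eq_add_neg, ← neg_one_smul ℂ (spec hX (fun a => (a : ℂ))), spec_smul, spec_add]
  refine spec_congr hX fun j => ?_
  rcases le_total 0 (hX.eigenvalues j) with h | h
  · rw [max_eq_left h, max_eq_right (by linarith)]; simp
  · rw [max_eq_right h, max_eq_left (by linarith)]; simp

lemma posPart_smul (hX : X.IsHermitian) {c : ℝ} (hc : 0 ≤ c) :
    posPart (c • X) = c • posPart X := by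
  have hX' : IsSelfAdjoint X := hX
  rw [posPart_eq_cfc (hX.smul (IsSelfAdjoint.all c)), posPart_eq_cfc hX,
    ← cfc_comp_smul c (fun a => max a 0) X
    ((Matrix.finite_real_spectrum.image _).continuousOn _), ← cfc_smul c (fun a => max a 0) X
    (Matrix.finite_real_spectrum.continuousOn _)]
  congr 1
  ext a
  simp only [smul_eq_mul]
  rw [mul_max_of_nonneg _ _ hc, mul_zero]

lemma posPart_eq_zero (hX : (-X).PosSemidef) : posPart X = 0 := by
  have hX' : X.IsHermitian := by simpa using hX.isHermitian.neg
  have h1 := posSemidef_posPart hX'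
  refine eq_zero_of_qf_eq_zero fun x => ?_
  have hev : ∀ j, hX'.eigenvalues j ≤ 0 := fun j => by
    have h2 := hX.qf_re (hX'.eigenvectorBasis j).ofLp
    rw [qf_neg, Complex.neg_re] at h2
    have h3 := hX'.eigenvalues_eq j
    have h4 : (qf (hX'.eigenvectorBasis j).ofLp X).re = hX'.eigenvalues j := by
      rw [h3]; rfl
    linarith
  rw [posPart_eq_spec hX', qf_spec]
  exact Finset.sum_eq_zero fun j _ => by rw [max_eq_right (hev j)]; simp

/-- The projection in the definition is discontinuous in the matrix, but its product with the matrix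
is the functional calculus of the continuous function $\max(a,0)$. -/
lemma continuous_posPart {α : Type*} [TopologicalSpace α] {f : α → Matrix (Fin n) (Fin n) ℂ}
    (hf : Continuous f) (hX : ∀ t, (f t).IsHermitian) : Continuous fun t => posPart (f t) := by
  have : (fun t => posPart (f t)) = fun t => cfc (fun a : ℝ => max a 0) (f t) := by
    ext1 t; exact posPart_eq_cfc (hX t)
  rw [this]
  refine Continuous.cfc_of_mem_nhdsSet (s := Set.univ) _ Filter.univ_mem hf hX (by fun_prop)

end PosPart

/-! ### Imaginary parts of resolvent terms for real parameters -/

section RealAxis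

variable {n : ℕ} {A B X : Matrix (Fin n) (Fin n) ℂ}

lemma res_smul_eq_spec (hX : X.IsHermitian) (c : ℝ) {y : ℝ} (hy : y ≠ 0) :
    res ((c : ℂ) • X) y = spec hX (fun a => (((c * a : ℝ) : ℂ) + y * Complex.I)⁻¹) := by
  have h1 : (c : ℂ) • X + ((y : ℂ) * Complex.I) • 1 =
      spec hX (fun a => ((c * a : ℝ) : ℂ) + y * Complex.I) := by
    nth_rewrite 1 [← spec_ofReal hX]
    rw [← spec_const hX, spec_smul, spec_add]
    push_cast; rfl
  rw [res, h1, inv_spec]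
  exact fun j => ofReal_add_mul_I_ne_zero (Or.inr hy)

lemma inv_ofReal_add_mul_I (a y : ℝ) : ((a : ℂ) + y * Complex.I)⁻¹ =
    ((a / (a ^ 2 + y ^ 2) : ℝ) : ℂ) + ((-y / (a ^ 2 + y ^ 2) : ℝ) : ℂ) * Complex.I := by
  have h : Complex.normSq ((a : ℂ) + y * Complex.I) = a ^ 2 + y ^ 2 := by
    rw [Complex.normSq_add_mul_I]
  refine Complex.ext ?_ ?_
  · rw [Complex.inv_re, h, Complex.add_re, Complex.add_re, Complex.re_ofReal_mul,
      Complex.re_ofReal_mul, Complex.ofReal_re, Complex.ofReal_re, Complex.I_re]; ring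
  · rw [Complex.inv_im, h, Complex.add_im, Complex.add_im, Complex.im_ofReal_mul,
      Complex.im_ofReal_mul, Complex.ofReal_im, Complex.ofReal_im, Complex.I_im]; ring

/-- The deviation of `-Im (y (c X + i y)⁻¹)` from the identity has integral `π/2 |c X|`. -/
lemma integral_nsq_add_im_res (hX : X.IsHermitian) (c : ℝ) (x : Fin n → ℂ) :
    IntegrableOn (fun y : ℝ => nsq x + (qf x ((y : ℂ) • res ((c : ℂ) • X) y)).im) (Set.Ioi 0) ∧
    (∀ y ∈ Set.Ioi (0 : ℝ), 0 ≤ nsq x + (qf x ((y : ℂ) • res ((c : ℂ) • X) y)).im) ∧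
    ∫ y in Set.Ioi (0 : ℝ), (nsq x + (qf x ((y : ℂ) • res ((c : ℂ) • X) y)).im) =
      Real.pi / 2 * (|c| * (qf x (spec hX (fun a => ((|a| : ℝ) : ℂ)))).re) := by
  -- For each eigenvalue $\lambda$ of $X$,
  -- $\operatorname{Im}\,y/(c\lambda+iy)=-y^2/((c\lambda)^2+y^2)$; adding $1$ leaves an integrable
  -- function.
  have he : ∀ y ∈ Set.Ioi (0 : ℝ), nsq x + (qf x ((y : ℂ) • res ((c : ℂ) • X) y)).im =
      ∑ j, ‖coord hX x j‖ ^ 2 *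
        ((c * hX.eigenvalues j) ^ 2 / ((c * hX.eigenvalues j) ^ 2 + y ^ 2)) := by
    intro y hy
    have hy0 : (0 : ℝ) < y := hy
    rw [res_smul_eq_spec hX c hy0.ne', spec_smul, qf_spec, Complex.im_sum, ← nsq_coord hX, nsq,
      ← Finset.sum_add_distrib]
    refine Finset.sum_congr rfl fun j _ => ?_
    rw [inv_ofReal_add_mul_I, ← Complex.ofReal_pow, Complex.im_mul_ofReal]
    have : (c * hX.eigenvalues j) ^ 2 + y ^ 2 ≠ 0 := by positivity
    rw [Complex.im_ofReal_mul, Complex.add_im, Complex.im_ofReal_mul, Complex.ofReal_im,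
      Complex.I_im]
    field_simp
    ring
  have hint := fun j => integral_sq_div_sq_add_sq (c * hX.eigenvalues j)
  have hi : IntegrableOn (fun y : ℝ => ∑ j, ‖coord hX x j‖ ^ 2 *
        ((c * hX.eigenvalues j) ^ 2 / ((c * hX.eigenvalues j) ^ 2 + y ^ 2))) (Set.Ioi 0) :=
    integrable_finsetSum _ fun j _ => (hint j).1.const_mul _
  refine ⟨hi.congr_fun (fun y hy => (he y hy).symm) measurableSet_Ioi, fun y hy => ?_, ?_⟩
  · rw [he y hy]
    exact Finset.sum_nonneg fun j _ => by positivity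
  · rw [setIntegral_congr_fun measurableSet_Ioi he,
      integral_finsetSum _ fun j _ => (hint j).1.const_mul _, qf_spec, Complex.re_sum,
      Finset.mul_sum, Finset.mul_sum]
    refine Finset.sum_congr rfl fun j _ => ?_
    rw [integral_const_mul, (hint j).2, abs_mul, ← Complex.ofReal_pow, Complex.re_mul_ofReal,
      Complex.ofReal_re]
    ring

/-- The discarded sum of $\operatorname{Im}z_{ij}\operatorname{Re}w_{ij}$ changes sign under
exchange of $i$ and $j$. -/
lemma im_sum_mul_of_symm {z w : Fin n → Fin n → ℂ} (hz : ∀ i j, z j i = star (z i j))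
    (hw : ∀ i j, w j i = w i j) :
    (∑ i, ∑ j, z i j * w i j).im = ∑ i, ∑ j, (z i j).re * (w i j).im := by
  have h0 : ∑ i, ∑ j, (z i j).im * (w i j).re = 0 := by
    have h1 : ∑ i, ∑ j, (z i j).im * (w i j).re = -∑ i, ∑ j, (z i j).im * (w i j).re := by
      conv_lhs => rw [Finset.sum_comm]
      simp only [← Finset.sum_neg_distrib]
      refine Finset.sum_congr rfl fun i _ => Finset.sum_congr rfl fun j _ => ?_
      rw [hz i j, hw i j]; simp
    linarith
  simp only [Complex.im_sum, Complex.mul_im, Finset.sum_add_distrib, h0, add_zero]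

lemma mul_im_inv_mul_inv {c : ℝ} (hc : c ≠ 0) {p q : ℝ} (y : ℝ) (hp : 0 < p) (hq : 0 < q) :
    ((y : ℂ) * ((((c * p : ℝ) : ℂ) + y * Complex.I)⁻¹ *
      (((c * q : ℝ) : ℂ) + y * Complex.I)⁻¹)).im =
      -(SignType.sign c : ℝ) * (y ^ 2 * (|c| * p + |c| * q) /
        (((|c| * p) ^ 2 + y ^ 2) * ((|c| * q) ^ 2 + y ^ 2))) := by
  have h1 : (c * p) ^ 2 + y ^ 2 ≠ 0 := by positivity
  have h2 : (c * q) ^ 2 + y ^ 2 ≠ 0 := by positivity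
  rw [Complex.im_ofReal_mul, inv_ofReal_add_mul_I, inv_ofReal_add_mul_I]
  simp only [Complex.mul_im, Complex.add_re, Complex.add_im, Complex.ofReal_re, Complex.ofReal_im,
    Complex.mul_re, Complex.I_re, Complex.I_im, mul_zero, mul_one, sub_zero, zero_add, add_zero]
  simp only [mul_pow, sq_abs]
  rw [← mul_pow, ← mul_pow]
  rcases lt_or_gt_of_ne hc with h | h
  · rw [sign_neg h, abs_of_neg h]
    simp only [SignType.coe_neg, SignType.coe_one]
    field_simp
  · rw [sign_pos h, abs_of_pos h]
    simp only [SignType.coe_one]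
    field_simp
    ring

/-- The imaginary part of `y (c B + i y)⁻¹ C (c B + i y)⁻¹` has an integral that depends on `c`
only through its sign. -/
lemma integral_im_res_mul_res {C : Matrix (Fin n) (Fin n) ℂ} (hC : C.IsHermitian) (hB : B.PosDef)
    (x : Fin n → ℂ) : ∃ K : ℝ, ∀ c : ℝ, c ≠ 0 →
    IntegrableOn (fun y : ℝ => (qf x ((y : ℂ) • (res ((c : ℂ) • B) y * C * res ((c : ℂ) • B) y))).im)
      (Set.Ioi 0) ∧
    ∫ y in Set.Ioi (0 : ℝ), |(qf x ((y : ℂ) • (res ((c : ℂ) • B) y * C * res ((c : ℂ) • B) y))).im|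
      ≤ K ∧
    ∫ y in Set.Ioi (0 : ℝ), (qf x ((y : ℂ) • (res ((c : ℂ) • B) y * C * res ((c : ℂ) • B) y))).im =
      -(SignType.sign c : ℝ) * (Real.pi / 2 * (qf x C).re) := by
  -- In the eigenbasis of $B$ the term is a double sum whose kernel depends on $c$ through its sign
  -- and through $p=|c|\lambda_i$, $q=|c|\lambda_j$ in `integral_sq_mul_add_div`. That integral is
  -- always $\pi/2$, so the sum collapses to $C$ and the $L^1$ bound `K` is uniform in $c$, even as
  -- $c\to0$.
  set hH := hB.isHermitian
  set U : Matrix (Fin n) (Fin n) ℂ := (hH.eigenvectorUnitary : Matrix (Fin n) (Fin n) ℂ) with hU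
  set ξ := coord hH x
  set lam := hH.eigenvalues
  set z : Fin n → Fin n → ℂ := fun i j => star (ξ i) * (Uᴴ * C * U) i j * ξ j with hz
  have hzs : ∀ i j, z j i = star (z i j) := by
    intro i j
    have h1 : (Uᴴ * C * U).IsHermitian := Matrix.isHermitian_conjTranspose_mul_mul U hC
    have h2 := h1.apply j i
    simp only [hz, star_mul', star_star]
    rw [← h2]; ring
  have hqC : qf x C = ∑ i, ∑ j, z i j := by
    have : C = U * (Uᴴ * C * U) * Uᴴ := by
      rw [← Matrix.mul_assoc, ← Matrix.mul_assoc, eigenvectorUnitary_mul_conjTranspose,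
        Matrix.one_mul, Matrix.mul_assoc, eigenvectorUnitary_mul_conjTranspose, Matrix.mul_one]
    conv_lhs => rw [this, qf_mul_mul_conjTranspose, qf_eq_sum]
    rfl
  have hint := fun (c : ℝ) (hc : c ≠ 0) (i j : Fin n) => integral_sq_mul_add_div
    (mul_pos (abs_pos.mpr hc) (hB.eigenvalues_pos i)) (mul_pos (abs_pos.mpr hc) (hB.eigenvalues_pos j))
  have he : ∀ c : ℝ, c ≠ 0 → ∀ y ∈ Set.Ioi (0 : ℝ),
      (qf x ((y : ℂ) • (res ((c : ℂ) • B) y * C * res ((c : ℂ) • B) y))).im =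
      ∑ i, ∑ j, -(SignType.sign c : ℝ) * (z i j).re * (y ^ 2 * (|c| * lam i + |c| * lam j) /
        (((|c| * lam i) ^ 2 + y ^ 2) * ((|c| * lam j) ^ 2 + y ^ 2))) := by
    intro c hc y hy
    have hy0 : (0 : ℝ) < y := hy
    set k : Fin n → ℂ := fun i => (((c * lam i : ℝ) : ℂ) + y * Complex.I)⁻¹ with hk
    have h1 : qf x ((y : ℂ) • (res ((c : ℂ) • B) y * C * res ((c : ℂ) • B) y)) =
        ∑ i, ∑ j, z i j * ((y : ℂ) * (k i * k j)) := by
      rw [res_smul_eq_spec hH c hy0.ne', qf_smul]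
      have h2 : spec hH (fun a => (((c * a : ℝ) : ℂ) + y * Complex.I)⁻¹) * C *
          spec hH (fun a => (((c * a : ℝ) : ℂ) + y * Complex.I)⁻¹) =
          U * (Matrix.diagonal k * (Uᴴ * C * U) * Matrix.diagonal k) * Uᴴ := by
        simp only [spec, Matrix.mul_assoc]; rfl
      rw [h2, qf_mul_mul_conjTranspose, qf_eq_sum, Finset.mul_sum]
      refine Finset.sum_congr rfl fun i _ => ?_
      rw [Finset.mul_sum]
      refine Finset.sum_congr rfl fun j _ => ?_
      rw [Matrix.mul_diagonal, Matrix.diagonal_mul]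
      change _ = star (ξ i) * (Uᴴ * C * U) i j * ξ j * _
      change (y : ℂ) * (star (ξ i) * _ * ξ j) = _
      ring
    rw [h1, im_sum_mul_of_symm hzs fun i j => by rw [mul_comm (k i)]]
    refine Finset.sum_congr rfl fun i _ => Finset.sum_congr rfl fun j _ => ?_
    rw [mul_im_inv_mul_inv hc y (hB.eigenvalues_pos i) (hB.eigenvalues_pos j)]
    ring
  have hi : ∀ c : ℝ, c ≠ 0 → ∀ i j, IntegrableOn (fun y : ℝ =>
      -(SignType.sign c : ℝ) * (z i j).re * (y ^ 2 * (|c| * lam i + |c| * lam j) /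
        (((|c| * lam i) ^ 2 + y ^ 2) * ((|c| * lam j) ^ 2 + y ^ 2)))) (Set.Ioi 0) :=
    fun c hc i j => (hint c hc i j).1.const_mul _
  refine ⟨∑ i, ∑ j, |(z i j).re| * (Real.pi / 2), fun c hc => ?_⟩
  have hiT : IntegrableOn (fun y : ℝ => (qf x ((y : ℂ) • (res ((c : ℂ) • B) y * C *
      res ((c : ℂ) • B) y))).im) (Set.Ioi 0) :=
    IntegrableOn.congr_fun (integrable_finsetSum _ fun i _ =>
      integrable_finsetSum _ fun j _ => hi c hc i j) (fun y hy => (he c hc y hy).symm)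
      measurableSet_Ioi
  refine ⟨hiT, ?_, ?_⟩
  · have hs1 : |(SignType.sign c : ℝ)| ≤ 1 := by
      rcases lt_or_gt_of_ne hc with h | h <;> simp [sign_neg, sign_pos, h]
    have hi2 : ∀ i j, IntegrableOn (fun y : ℝ =>
      |(z i j).re| * (y ^ 2 * (|c| * lam i + |c| * lam j) /
        (((|c| * lam i) ^ 2 + y ^ 2) * ((|c| * lam j) ^ 2 + y ^ 2)))) (Set.Ioi 0) :=
      fun i j => (hint c hc i j).1.const_mul _
    have hi3 := integrable_finsetSum Finset.univ fun i _ =>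
      integrable_finsetSum Finset.univ fun j _ => hi2 i j
    refine (setIntegral_mono_on hiT.abs hi3 measurableSet_Ioi fun y hy => ?_).trans_eq ?_
    · rw [he c hc y hy]
      refine (Finset.abs_sum_le_sum_abs _ _).trans (Finset.sum_le_sum fun i _ => ?_)
      refine (Finset.abs_sum_le_sum_abs _ _).trans (Finset.sum_le_sum fun j _ => ?_)
      have hli := hB.eigenvalues_pos i
      have hlj := hB.eigenvalues_pos j
      have h0 : 0 ≤ y ^ 2 * (|c| * lam i + |c| * lam j) /
          (((|c| * lam i) ^ 2 + y ^ 2) * ((|c| * lam j) ^ 2 + y ^ 2)) := by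
        have : 0 < lam i := hli
        have : 0 < lam j := hlj
        positivity
      rw [abs_mul, abs_mul, abs_neg, abs_of_nonneg h0]
      refine mul_le_mul_of_nonneg_right ?_ h0
      exact mul_le_of_le_one_left (abs_nonneg _) hs1
    · rw [integral_finsetSum _ fun i _ => integrable_finsetSum _ fun j _ => hi2 i j]
      refine Finset.sum_congr rfl fun i _ => ?_
      rw [integral_finsetSum _ fun j _ => hi2 i j]
      refine Finset.sum_congr rfl fun j _ => ?_
      rw [integral_const_mul, (hint c hc i j).2]
  · rw [setIntegral_congr_fun measurableSet_Ioi (he c hc),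
      integral_finsetSum _ fun i _ => integrable_finsetSum _ fun j _ => hi c hc i j, hqC,
      Complex.re_sum, Finset.mul_sum, Finset.mul_sum]
    refine Finset.sum_congr rfl fun i _ => ?_
    rw [integral_finsetSum _ fun j _ => hi c hc i j, Complex.re_sum, Finset.mul_sum,
      Finset.mul_sum]
    refine Finset.sum_congr rfl fun j _ => ?_
    rw [integral_const_mul, (hint c hc i j).2]
    ring

end RealAxis

/-! ### Boundary values on the real axis -/

section Boundary

variable {n : ℕ} {A B : Matrix (Fin n) (Fin n) ℂ}

lemma ofReal_smul_matrix (c : ℝ) (M : Matrix (Fin n) (Fin n) ℂ) : (c : ℂ) • M = c • M :=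
  Complex.coe_smul c M

lemma isHermitian_add_real_smul (hA : A.IsHermitian) (hB : B.IsHermitian) (c : ℝ) :
    (A + c • B).IsHermitian := hA.add (hB.smul (IsSelfAdjoint.all c))

/-- The boundary values of the imaginary part of the integrated kernel. -/
def boundaryValue (A B : Matrix (Fin n) (Fin n) ℂ) (x : Fin n → ℂ) (E : ℝ) : ℝ :=
  -(Real.pi * (qf x (if 0 < 1 + E then posPart (-(A + E • B)) else posPart (A + E • B))).re)

/-- With $X=A+EB$ and $Y=(1+E)B$, the integrals of the three terms of `psi_eq` add up to
$-\frac\pi2\big(|X|-\operatorname{sign}(1+E)X\big)$, tested on $x$. The function `g` bounds the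
$L^1$ norms continuously across the excluded point $E=-1$, which Fubini's theorem requires. -/
lemma integral_im_psi (hA : A.IsHermitian) (hB : B.PosDef) (x : Fin n → ℂ) :
    ∃ g : ℝ → ℝ, Continuous g ∧ ∀ E : ℝ, 1 + E ≠ 0 →
    IntegrableOn (fun y : ℝ => (qf x (psi A B E y)).im) (Set.Ioi 0) ∧
    ∫ y in Set.Ioi (0 : ℝ), |(qf x (psi A B E y)).im| ≤ g E ∧
    ∫ y in Set.Ioi (0 : ℝ), (qf x (psi A B E y)).im = boundaryValue A B x E := by
  have hC : (A - B).IsHermitian := hA.sub hB.isHermitian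
  obtain ⟨K, hK⟩ := integral_im_res_mul_res hC hB x
  have hX := isHermitian_add_real_smul hA hB.isHermitian
  set p : ℝ → ℝ := fun E => Real.pi / 2 * (2 * (qf x (posPart (A + E • B))).re -
    (qf x (A + E • B)).re) with hp
  set q : ℝ → ℝ := fun E => Real.pi / 2 * (|1 + E| * (qf x B).re) with hq
  have hpc : Continuous p := by
    have h1 : Continuous fun E : ℝ => A + E • B := by fun_prop
    have h2 := (continuous_qf x).comp (continuous_posPart h1 hX)
    have h3 := (continuous_qf x).comp h1
    exact continuous_const.mul ((continuous_const.mul (Complex.continuous_re.comp h2)).sub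
      (Complex.continuous_re.comp h3))
  have hqc : Continuous q := by fun_prop
  refine ⟨fun E => p E + q E + K, by fun_prop, fun E hE => ?_⟩
  obtain ⟨k1, k2, k3⟩ := hK (1 + E) hE
  obtain ⟨x1, x2, x3⟩ := integral_nsq_add_im_res (hX E) 1 x
  obtain ⟨y1, y2, y3⟩ := integral_nsq_add_im_res hB.isHermitian (1 + E) x
  rw [spec_abs_add, qf_sub, qf_smul, Complex.sub_re, abs_one, one_mul, Complex.mul_re,
    Complex.re_ofNat, Complex.im_ofNat, zero_mul, sub_zero] at x3
  have hBabs : spec hB.isHermitian (fun a => ((|a| : ℝ) : ℂ)) = B := by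
    have h1 := posPart_neg hB.isHermitian
    rw [posPart_eq_zero (X := -B) (by simpa using hB.posSemidef)] at h1
    rw [spec_abs_add, sub_eq_zero.mp h1.symm, two_smul]; abel
  rw [hBabs] at y3
  simp only [Complex.ofReal_one, one_smul, Complex.ofReal_add] at x1 x2 x3 y1 y2 y3 k1 k2 k3
  -- The first two terms of `psi` are not integrable separately in general; adding and subtracting
  -- $\|x\|^2$ makes each one integrable.
  have he : ∀ y ∈ Set.Ioi (0 : ℝ), -(nsq x + (qf x ((y : ℂ) • res (A + E • B) y)).im) +
      (nsq x + (qf x ((y : ℂ) • res ((1 + (E : ℂ)) • B) y)).im) -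
      (qf x ((y : ℂ) • (res ((1 + (E : ℂ)) • B) y * (A - B) * res ((1 + (E : ℂ)) • B) y))).im =
      (qf x (psi A B E y)).im := by
    intro y hy
    rw [psi_eq hA hB.posSemidef (by simp) hy, qf_sub, qf_add, qf_neg, ofReal_smul_matrix E]
    simp only [Complex.sub_im, Complex.add_im, Complex.neg_im]
    ring
  have i1 := x1.neg.add y1
  have hi : IntegrableOn (fun y : ℝ => (qf x (psi A B E y)).im) (Set.Ioi 0) :=
    IntegrableOn.congr_fun (i1.sub k1) (fun y hy => he y hy) measurableSet_Ioi
  refine ⟨hi, ?_, ?_⟩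
  · have i2 := (x1.add y1).add k1.abs
    refine (setIntegral_mono_on hi.abs i2 measurableSet_Ioi fun y hy => ?_).trans ?_
    · rw [← he y hy]
      have h1 := x2 y hy
      have h2 := y2 y hy
      have h3 := abs_le.mp (le_refl |(qf x ((y : ℂ) • (res ((1 + (E : ℂ)) • B) y * (A - B) *
        res ((1 + (E : ℂ)) • B) y))).im|)
      simp only [Pi.add_apply]
      rw [abs_le]
      constructor <;> linarith
    · rw [integral_add' (x1.add y1) k1.abs, integral_add' x1 y1, x3, y3]
      exact add_le_add le_rfl k2
  · rw [← setIntegral_congr_fun measurableSet_Ioi he]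
    have e1 := integral_sub' i1 k1
    have e2 := integral_add' x1.neg y1
    have e3 := integral_neg' (μ := volume.restrict (Set.Ioi (0 : ℝ)))
      (fun y : ℝ => nsq x + (qf x ((y : ℂ) • res (A + E • B) y)).im)
    rw [e3, x3, y3] at e2
    rw [e2, k3] at e1
    refine e1.trans ?_
    have hXeq : qf x (A + E • B) = qf x (A - B) + (1 + E) * qf x B := by
      rw [qf_add, qf_sub, qf_real_smul]; ring
    have hXre : (qf x (A + E • B)).re = (qf x (A - B)).re + (1 + E) * (qf x B).re := by
      rw [hXeq, Complex.add_re]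
      congr 1
      rw [show (1 + (E : ℂ)) = ((1 + E : ℝ) : ℂ) by push_cast; rfl, Complex.re_ofReal_mul]
    rw [boundaryValue]
    split_ifs with h
    · rw [sign_pos h, abs_of_pos h, posPart_neg (hX E), qf_sub x (posPart _), Complex.sub_re, SignType.coe_one,
        hXre]
      ring
    · have h' : 1 + E < 0 := lt_of_le_of_ne (not_lt.mp h) hE
      rw [sign_neg h', abs_of_neg h', hXre, SignType.coe_neg, SignType.coe_one]
      ring

lemma continuousOn_qf_psi (hA : A.IsHermitian) (hB : B.PosSemidef) (x : Fin n → ℂ) {e : ℝ → ℝ}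
    (he : Continuous e) :
    ContinuousOn (fun p : ℝ × ℝ => qf x (psi A B (e p.1) p.2)) (Set.univ ×ˢ Set.Ioi 0) := by
  intro p hp
  have h1 : ContinuousAt (fun p : ℝ × ℝ => psi A B (e p.1 : ℂ) p.2) p :=
    continuousAt_psi hA hB (by fun_prop) continuousAt_snd (by simp) hp.2
  exact ((continuous_qf x).continuousAt.comp h1).continuousWithinAt

/-- Fubini's theorem along a path of real parameters, used for $E=\pm e^s$. The path may meet $E=-1$
on a null set. -/
theorem integral_intervalIntegral_im_psi (hA : A.IsHermitian) (hB : B.PosDef) (x : Fin n → ℂ)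
    {e : ℝ → ℝ} (he : Continuous e) (hne : ∀ᵐ s : ℝ, 1 + e s ≠ 0) {a b : ℝ} (hab : a ≤ b) :
    IntegrableOn (fun y : ℝ => ∫ s in a..b, (qf x (psi A B (e s) y)).im) (Set.Ioi 0) ∧
    ∫ y in Set.Ioi (0 : ℝ), ∫ s in a..b, (qf x (psi A B (e s) y)).im =
      ∫ s in a..b, boundaryValue A B x (e s) := by
  obtain ⟨g, hg, hE⟩ := integral_im_psi hA hB x
  set μ := volume.restrict (Set.Ioc a b)
  set ν := volume.restrict (Set.Ioi (0 : ℝ))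
  set F : ℝ × ℝ → ℝ := fun p => (qf x (psi A B (e p.1) p.2)).im with hF
  have hm : AEStronglyMeasurable F (μ.prod ν) := by
    rw [Measure.prod_restrict]
    have h1 : ContinuousOn F (Set.Ioc a b ×ˢ Set.Ioi 0) :=
      (Complex.continuous_im.comp_continuousOn
        (continuousOn_qf_psi hA hB.posSemidef x he)).mono
        (Set.prod_mono_left (Set.subset_univ _))
    exact h1.aestronglyMeasurable (measurableSet_Ioc.prod measurableSet_Ioi)
  have hneμ : ∀ᵐ s ∂μ, 1 + e s ≠ 0 := ae_restrict_of_ae hne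
  have hi : Integrable F (μ.prod ν) := by
    rw [integrable_prod_iff hm]
    refine ⟨hneμ.mono fun s hs => (hE (e s) hs).1, ?_⟩
    have hgi : Integrable (fun s => g (e s)) μ :=
      ((hg.comp he).integrableOn_Icc (a := a) (b := b)).mono_set Set.Ioc_subset_Icc_self
    refine hgi.mono' hm.norm.integral_prod_right' (hneμ.mono fun s hs => ?_)
    rw [Real.norm_of_nonneg (integral_nonneg fun _ => norm_nonneg _)]
    exact (hE (e s) hs).2.1
  simp only [intervalIntegral.integral_of_le hab]
  refine ⟨hi.integral_prod_right, ?_⟩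
  rw [← integral_integral_swap (f := fun s y => F (s, y)) hi]
  exact integral_congr_ae (hneμ.mono fun s hs => (hE (e s) hs).2.2)

end Boundary

/-! ### The limit of the contour identity -/

section Limit

variable {n : ℕ} {A B : Matrix (Fin n) (Fin n) ℂ}

lemma boundaryValue_of_nonneg (hA : A.PosSemidef) (hB : B.PosSemidef) (x : Fin n → ℂ) {E : ℝ}
    (hE : 0 ≤ E) : boundaryValue A B x E = 0 := by
  have h : (A + E • B).PosSemidef := hA.add (hB.smul hE)
  rw [boundaryValue, if_pos (by positivity), posPart_eq_zero (by simpa using h), qf_zero]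
  simp

/-- The imaginary part is the boundary value at $E=0$, which vanishes because $A\ge0$ has no
negative part. -/
lemma im_qf_Δ (hA : A.PosSemidef) (hB : B.PosDef) (x : Fin n → ℂ) : (qf x (Δ A B)).im = 0 := by
  obtain ⟨g, -, h⟩ := integral_im_psi hA.isHermitian hB x
  have h0 := (h 0 (by simp)).2.2
  rw [boundaryValue_of_nonneg hA hB.posSemidef x le_rfl, Complex.ofReal_zero] at h0
  have h1 := integral_psi_zero hA hB
  have h2 := (qfCLM x).integral_comp_comm h1.1
  have h3 := Complex.imCLM.integral_comp_comm ((qfCLM x).integrable_comp h1.1)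
  simp only [qfCLM_apply, Complex.imCLM_apply] at h2 h3
  rw [← h1.2, ← h2, ← h3, h0]

lemma continuous_qf_psi_exp (hA : A.IsHermitian) (hB : B.PosSemidef) (x : Fin n → ℂ) {y : ℝ}
    (hy : 0 < y) {e : ℝ → ℝ} (he : Continuous e) :
    Continuous fun s => qf x (psi A B (e s) y) :=
  continuous_iff_continuousAt.mpr fun s => (continuous_qf x).continuousAt.comp
    (continuousAt_psi (y := fun _ => y) hA hB (by fun_prop) continuousAt_const (by simp) hy)

lemma im_contour_psi (hA : A.IsHermitian) (hB : B.PosSemidef) (x : Fin n → ℂ) (S : ℝ) {y : ℝ}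
    (hy : 0 < y) :
    (arc A B x (-S) y).re - (arc A B x S y).re =
      (∫ s in (-S)..S, (qf x (psi A B (Real.exp s : ℝ) y)).im) -
      ∫ s in (-S)..S, (qf x (psi A B (-Real.exp s : ℝ) y)).im := by
  have h := congrArg Complex.im (contour_psi hA hB x S hy)
  have h1 := Complex.imCLM.intervalIntegral_comp_comm
    ((continuous_qf_psi_exp hA hB x hy Real.continuous_exp).intervalIntegrable (μ := volume) (-S) S)
  have h2 := Complex.imCLM.intervalIntegral_comp_comm
    ((continuous_qf_psi_exp hA hB x hy (e := fun s => -Real.exp s) Real.continuous_exp.neg).intervalIntegrable (μ := volume) (-S) S)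
  simp only [Complex.imCLM_apply] at h1 h2
  simp only [Complex.sub_im, Complex.add_im, Complex.mul_im, Complex.I_re, Complex.I_im, zero_mul,
    one_mul, zero_add, Complex.zero_im, ← h1, ← h2] at h
  linarith

lemma norm_qf_psi_exp_le (hA : A.IsHermitian) (hB : B.PosSemidef) (x : Fin n → ℂ) {b : ℝ}
    (hb : 0 < b) (hle : ∀ x, b * nsq x ≤ (qf x B).re) {r θ : ℝ} (hθ : θ ∈ Set.Icc 0 Real.pi)
    {d : ℝ} (hd : 0 < d) (hr : d ≤ |1 - Real.exp r|) {y : ℝ} (hy : 0 < y) :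
    ‖qf x (psi A B (Complex.exp (r + θ * Complex.I)) y)‖ ≤
      ‖A - B‖ ^ 2 / ((d * b) ^ 2 + y ^ 2) * nsq x := by
  refine (norm_qf_le _ _).trans (mul_le_mul_of_nonneg_right ?_ (nsq_nonneg x))
  refine norm_psi_le hA hB hb hle (exp_add_mul_I_im_nonneg r hθ) hd (hr.trans ?_) hy
  have h1 : ‖Complex.exp (r + θ * Complex.I)‖ = Real.exp r := by
    rw [Complex.norm_exp]; simp
  have h2 := abs_norm_sub_norm_le (1 : ℂ) (-Complex.exp (r + θ * Complex.I))
  rwa [norm_one, norm_neg, h1, sub_neg_eq_add] at h2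

lemma norm_arc_le (hA : A.IsHermitian) (hB : B.PosSemidef) (x : Fin n → ℂ) {b : ℝ}
    (hb : 0 < b) (hle : ∀ x, b * nsq x ≤ (qf x B).re) {r : ℝ} {d : ℝ} (hd : 0 < d)
    (hr : d ≤ |1 - Real.exp r|) {y : ℝ} (hy : 0 < y) :
    ‖arc A B x r y‖ ≤ ‖A - B‖ ^ 2 / ((d * b) ^ 2 + y ^ 2) * nsq x * Real.pi := by
  have h := intervalIntegral.norm_integral_le_of_norm_le_const (a := 0) (b := Real.pi)
    (f := fun θ : ℝ => qf x (psi A B (Complex.exp (r + θ * Complex.I)) y))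
    (C := ‖A - B‖ ^ 2 / ((d * b) ^ 2 + y ^ 2) * nsq x) fun θ hθ => by
      rw [Set.uIoc_of_le Real.pi_pos.le] at hθ
      exact norm_qf_psi_exp_le hA hB x hb hle (Set.Ioc_subset_Icc_self hθ) hd hr hy
  rwa [sub_zero, abs_of_pos Real.pi_pos] at h

lemma half_le_abs_one_sub_exp {r : ℝ} (hr : 1 ≤ |r|) : 1 / 2 ≤ |1 - Real.exp r| := by
  rcases le_abs.mp hr with h | h
  · have := Real.add_one_le_exp r
    rw [abs_of_nonpos (by linarith)]; linarith
  · have h1 := Real.add_one_le_exp (-r)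
    have h2 : Real.exp r * Real.exp (-r) = 1 := by rw [← Real.exp_add]; simp
    have h3 := Real.exp_pos r
    have : Real.exp r ≤ 1 / 2 := by nlinarith
    rw [abs_of_nonneg (by linarith)]; linarith

lemma tendsto_arc_atTop (hA : A.IsHermitian) (hB : B.PosDef) (x : Fin n → ℂ) {y : ℝ}
    (hy : 0 < y) : Tendsto (fun S => arc A B x S y) atTop (𝓝 0) := by
  obtain ⟨b, hb, hle⟩ := exists_pos_le_qf hB
  rw [tendsto_zero_iff_norm_tendsto_zero]
  -- The arc of radius $e^S$ keeps distance at least $e^S-1\ge S$ from $-1$, so $d=S$ is allowed in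
  -- `norm_arc_le`.
  have hbd : ∀ᶠ S : ℝ in atTop, ‖arc A B x S y‖ ≤
      ‖A - B‖ ^ 2 / ((S * b) ^ 2 + y ^ 2) * nsq x * Real.pi := by
    filter_upwards [eventually_gt_atTop 0] with S hS
    refine norm_arc_le hA hB.posSemidef x hb hle hS ?_ hy
    have := Real.add_one_le_exp S
    rw [abs_of_nonpos (by linarith)]; linarith
  refine squeeze_zero' (Eventually.of_forall fun _ => norm_nonneg _) hbd ?_
  have h1 : Tendsto (fun S : ℝ => (S * b) ^ 2 + y ^ 2) atTop atTop :=
    tendsto_atTop_add_const_right _ _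
      ((tendsto_pow_atTop two_ne_zero).comp (tendsto_id.atTop_mul_const hb))
  have h2 := (((tendsto_const_nhds (x := ‖A - B‖ ^ 2)).div_atTop h1).mul_const
    (nsq x)).mul_const Real.pi
  simpa using h2

/-- The small half circle shrinks to $E=0$, where the kernel is continuous; $\pi$ is the length of
the angular interval. -/
lemma tendsto_arc_neg_atTop (hA : A.IsHermitian) (hB : B.PosDef) (x : Fin n → ℂ) {y : ℝ}
    (hy : 0 < y) :
    Tendsto (fun S => arc A B x (-S) y) atTop (𝓝 (Real.pi * qf x (psi A B 0 y))) := by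
  obtain ⟨b, hb, hle⟩ := exists_pos_le_qf hB
  have hc : (Real.pi : ℂ) * qf x (psi A B 0 y) = ∫ _ in (0 : ℝ)..Real.pi, qf x (psi A B 0 y) := by
    rw [intervalIntegral.integral_const, sub_zero, Complex.real_smul]
  rw [hc]
  refine intervalIntegral.tendsto_integral_filter_of_dominated_convergence
    (fun _ => ‖A - B‖ ^ 2 / ((1 / 2 * b) ^ 2 + y ^ 2) * nsq x) ?_ ?_
    intervalIntegrable_const ?_
  · refine Eventually.of_forall fun S => ?_
    rw [Set.uIoc_of_le Real.pi_pos.le]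
    refine ContinuousOn.aestronglyMeasurable (fun θ hθ => ?_) measurableSet_Ioc
    refine ContinuousAt.continuousWithinAt ?_
    refine (continuous_qf x).continuousAt.comp (f := fun θ : ℝ =>
      psi A B (Complex.exp ((-S : ℝ) + θ * Complex.I)) y) ?_
    exact continuousAt_psi (y := fun _ => y) hA hB.posSemidef
      (E := fun θ : ℝ => Complex.exp ((-S : ℝ) + θ * Complex.I)) (by fun_prop) continuousAt_const
      (exp_add_mul_I_im_nonneg _ (Set.Ioc_subset_Icc_self hθ)) hy
  · filter_upwards [eventually_ge_atTop 1] with S hS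
    refine ae_of_all _ fun θ hθ => ?_
    rw [Set.uIoc_of_le Real.pi_pos.le] at hθ
    refine norm_qf_psi_exp_le hA hB.posSemidef x hb hle (Set.Ioc_subset_Icc_self hθ) (by norm_num)
      (half_le_abs_one_sub_exp ?_) hy
    rw [abs_neg]; exact hS.trans (le_abs_self S)
  · refine ae_of_all _ fun θ _ => ?_
    have h1 : Tendsto (fun S : ℝ => Complex.exp ((-S : ℝ) + θ * Complex.I)) atTop (𝓝 0) := by
      rw [tendsto_zero_iff_norm_tendsto_zero]
      simp only [Complex.norm_exp, Complex.add_re, Complex.ofReal_re, Complex.mul_re, Complex.I_re,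
        Complex.ofReal_im, Complex.I_im, mul_zero, mul_one, sub_zero, add_zero]
      exact Real.tendsto_exp_neg_atTop_nhds_zero
    have h2 : ContinuousAt (fun E => qf x (psi A B E y)) 0 :=
      (continuous_qf x).continuousAt.comp
        (continuousAt_psi (y := fun _ => y) (E := id) hA hB.posSemidef continuousAt_id
          continuousAt_const (by simp) hy)
    exact h2.tendsto.comp h1

/-- The imaginary part of the contour identity is integrated over $y$. The real-axis side is
evaluated by Fubini at finite $S$; the arcs are passed to the limit by dominated convergence in $y$,
with $d=1/2$ in the bound for every $S\ge1$. -/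
theorem tendsto_integral_boundaryValue (hA : A.PosSemidef) (hB : B.PosDef) (x : Fin n → ℂ) :
    Tendsto (fun S : ℝ => ∫ s in (-S)..S, boundaryValue A B x (-Real.exp s)) atTop
      (𝓝 (-(Real.pi * (qf x (Δ A B)).re))) := by
  obtain ⟨b, hb, hle⟩ := exists_pos_le_qf hB
  have hH := hA.isHermitian
  have hS := hB.posSemidef
  have hint : ∀ S : ℝ, 0 ≤ S →
      IntegrableOn (fun y => (arc A B x (-S) y).re - (arc A B x S y).re) (Set.Ioi 0) ∧
      ∫ y in Set.Ioi (0 : ℝ), ((arc A B x (-S) y).re - (arc A B x S y).re) =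
        -∫ s in (-S)..S, boundaryValue A B x (-Real.exp s) := by
    intro S hS0
    have h1 := integral_intervalIntegral_im_psi hH hB x Real.continuous_exp
      (ae_of_all _ fun s => by positivity) (neg_le_self hS0)
    have h2 := integral_intervalIntegral_im_psi hH hB x (e := fun s => -Real.exp s)
      Real.continuous_exp.neg (by
      -- The path $-e^s$ meets $-1$ only at $s=0$.
      have : ∀ᵐ s : ℝ, s ≠ 0 := by simp [ae_iff, measure_singleton]
      filter_upwards [this] with s hs h
      exact hs (Real.exp_eq_one_iff s |>.mp (by linarith))) (neg_le_self hS0)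
    have he : ∀ y ∈ Set.Ioi (0 : ℝ), (∫ s in (-S)..S, (qf x (psi A B (Real.exp s : ℝ) y)).im) -
        ∫ s in (-S)..S, (qf x (psi A B (-Real.exp s : ℝ) y)).im =
        (arc A B x (-S) y).re - (arc A B x S y).re :=
      fun y hy => (im_contour_psi hH hS x S hy).symm
    refine ⟨IntegrableOn.congr_fun (h1.1.sub h2.1) he measurableSet_Ioi, ?_⟩
    rw [← setIntegral_congr_fun measurableSet_Ioi he, integral_sub h1.1 h2.1, h1.2, h2.2]
    simp [boundaryValue_of_nonneg hA hS x (Real.exp_pos _).le]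
  have hlim : Tendsto (fun S : ℝ => ∫ y in Set.Ioi (0 : ℝ),
      ((arc A B x (-S) y).re - (arc A B x S y).re)) atTop
      (𝓝 (∫ y in Set.Ioi (0 : ℝ), Real.pi * (qf x (psi A B 0 y)).re)) := by
    have hbi : IntegrableOn (fun y : ℝ =>
        2 * (‖A - B‖ ^ 2 / ((1 / 2 * b) ^ 2 + y ^ 2) * nsq x * Real.pi)) (Set.Ioi 0) :=
      (((integral_const_div_sq_add_sq (by positivity) _).1.mul_const _).mul_const _).const_mul 2
    refine tendsto_integral_filter_of_dominated_convergence _ ?_ ?_ hbi ?_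
    · filter_upwards [eventually_ge_atTop 0] with S hS0
      exact (hint S hS0).1.aestronglyMeasurable
    · filter_upwards [eventually_ge_atTop 1] with S hS1
      filter_upwards [ae_restrict_mem measurableSet_Ioi] with y hy
      have hS1' : 1 ≤ |S| := hS1.trans (le_abs_self S)
      have h1 := norm_arc_le hH hS x hb hle (by norm_num) (half_le_abs_one_sub_exp hS1') hy
      have h2 := norm_arc_le hH hS x hb hle (by norm_num)
        (half_le_abs_one_sub_exp (by rwa [abs_neg])) hy (r := -S)
      have h3 := Complex.abs_re_le_norm (arc A B x S y)
      have h4 := Complex.abs_re_le_norm (arc A B x (-S) y)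
      rw [Real.norm_eq_abs, two_mul]
      exact (abs_sub _ _).trans (add_le_add (h4.trans h2) (h3.trans h1))
    · filter_upwards [ae_restrict_mem measurableSet_Ioi] with y hy
      have h1 := (Complex.continuous_re.tendsto _).comp (tendsto_arc_atTop hH hB x hy)
      have h2 := (Complex.continuous_re.tendsto _).comp (tendsto_arc_neg_atTop hH hB x hy)
      have h3 := h2.sub h1
      rw [Complex.re_ofReal_mul, Complex.zero_re, sub_zero] at h3
      exact h3
  have hval : ∫ y in Set.Ioi (0 : ℝ), Real.pi * (qf x (psi A B 0 y)).re =
      Real.pi * (qf x (Δ A B)).re := by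
    have h1 := integral_psi_zero hA hB
    have h2 := (qfCLM x).integral_comp_comm h1.1
    have h3 := Complex.reCLM.integral_comp_comm ((qfCLM x).integrable_comp h1.1)
    simp only [qfCLM_apply, Complex.reCLM_apply] at h2 h3
    rw [integral_const_mul, h3, h2, h1.2]
  rw [hval] at hlim
  refine hlim.neg.congr' ?_
  filter_upwards [eventually_ge_atTop 0] with S hS0
  rw [(hint S hS0).2, neg_neg]

end Limit

/-! ### From boundary values to the partial integrals -/

section PartialIntegral

variable {n : ℕ} {A B : Matrix (Fin n) (Fin n) ℂ}

lemma isHermitian_sub_real_smul (hA : A.IsHermitian) (hB : B.IsHermitian) (c : ℝ) :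
    (A - c • B).IsHermitian := hA.sub (hB.smul (IsSelfAdjoint.all c))

lemma continuous_O (hA : A.IsHermitian) (hB : B.IsHermitian) : Continuous fun γ => O γ A B :=
  continuous_posPart (by fun_prop) (isHermitian_sub_real_smul hA hB)

lemma posSemidef_O (hA : A.IsHermitian) (hB : B.IsHermitian) (γ : ℝ) : (O γ A B).PosSemidef :=
  posSemidef_posPart (isHermitian_sub_real_smul hA hB γ)

lemma continuousOn_integrand (hA : A.IsHermitian) (hB : B.IsHermitian) :
    ContinuousOn (integrand A B) (Set.Ioi 0) := by
  have h1 := (continuous_O hA hB).continuousOn (s := Set.Ioi 0)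
  have h2 := (continuous_O hB hA).continuousOn (s := Set.Ioi 0)
  have h3 : ContinuousOn (fun γ : ℝ => γ⁻¹) (Set.Ioi 0) :=
    continuousOn_id.inv₀ fun γ hγ => ne_of_gt hγ
  have h4 : ContinuousOn (fun γ : ℝ => (γ ^ 2)⁻¹) (Set.Ioi 0) :=
    (continuousOn_id.pow 2).inv₀ fun γ hγ => pow_ne_zero 2 (ne_of_gt hγ)
  exact (h3.smul h1).add (h4.smul h2)

lemma posSemidef_integrand (hA : A.IsHermitian) (hB : B.IsHermitian) {γ : ℝ} (hγ : 0 ≤ γ) :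
    (integrand A B γ).PosSemidef :=
  ((posSemidef_O hA hB γ).smul (inv_nonneg.mpr hγ)).add
    ((posSemidef_O hB hA γ).smul (by positivity))

lemma intervalIntegrable_integrand (hA : A.IsHermitian) (hB : B.IsHermitian) {s t : ℝ}
    (hs : 1 ≤ s) (ht : 1 ≤ t) : IntervalIntegrable (integrand A B) volume s t := by
  refine ((continuousOn_integrand hA hB).mono fun γ hγ => ?_).intervalIntegrable
  have : 1 ≤ γ := (le_inf hs ht).trans hγ.1
  exact one_pos.trans_le this

lemma qf_intervalIntegral_integrand (hA : A.IsHermitian) (hB : B.IsHermitian) (x : Fin n → ℂ)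
    {s t : ℝ} (hs : 1 ≤ s) (ht : 1 ≤ t) :
    qf x (∫ γ in s..t, integrand A B γ) = ((∫ γ in s..t, (qf x (integrand A B γ)).re : ℝ) : ℂ) := by
  have hi := intervalIntegrable_integrand hA hB hs ht
  have h1 := (qfCLM x).intervalIntegral_comp_comm hi
  simp only [qfCLM_apply] at h1
  rw [← h1, ← intervalIntegral.integral_ofReal]
  refine intervalIntegral.integral_congr fun γ hγ => ?_
  have : 1 ≤ γ := (le_inf hs ht).trans hγ.1
  exact (posSemidef_integrand hA hB (zero_le_one.trans this)).isHermitian.qf_eq_re x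

/-- With $\gamma=e^s$ and $d\gamma=e^s\,ds$, homogeneity of the positive part turns
$\gamma^{-1}O_\gamma(B\|A)$ into $(A-\gamma^{-1}B)_-$. Thus the two terms of the integrand are the
boundary values at $s$ and at $-s$. -/
lemma exp_mul_integrand (hA : A.IsHermitian) (hB : B.IsHermitian) (s : ℝ) :
    Real.exp s • integrand A B (Real.exp s) =
      posPart (A - Real.exp s • B) + posPart (-(A - Real.exp (-s) • B)) := by
  have h0 := Real.exp_pos s
  have h1 : -(A - Real.exp (-s) • B) = Real.exp (-s) • (B - Real.exp s • A) := by
    rw [smul_sub, smul_smul, ← Real.exp_add, neg_add_cancel, Real.exp_zero, one_smul]; abel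
  rw [h1, posPart_smul (isHermitian_sub_real_smul hB hA _) (Real.exp_pos _).le, integrand, smul_add,
    smul_smul, smul_smul, mul_inv_cancel₀ h0.ne', one_smul, Real.exp_neg, O, O]
  congr 2
  field_simp

lemma integral_boundaryValue_eq (hA : A.IsHermitian) (hB : B.IsHermitian) (x : Fin n → ℂ) {S : ℝ}
    (hS : 0 ≤ S) : ∫ s in (-S)..S, boundaryValue A B x (-Real.exp s) =
      -(Real.pi * (qf x (partialIntegral A B (Real.exp S))).re) := by
  set p : ℝ → ℝ := fun s => (qf x (posPart (A - Real.exp s • B))).re with hp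
  set m : ℝ → ℝ := fun s => (qf x (posPart (-(A - Real.exp s • B)))).re with hm
  have hX := fun s => isHermitian_sub_real_smul hA hB (Real.exp s)
  have hcont : Continuous fun s : ℝ => A - Real.exp s • B := by fun_prop
  have hpc : Continuous p := Complex.continuous_re.comp
    ((continuous_qf x).comp (continuous_posPart hcont hX))
  have hmc : Continuous m := Complex.continuous_re.comp
    ((continuous_qf x).comp (continuous_posPart hcont.neg fun s => (hX s).neg))
  have hbp : ∀ s, 0 < s → -(Real.pi * p s) = boundaryValue A B x (-Real.exp s) := fun s hs => by
    have : 1 < Real.exp s := Real.one_lt_exp_iff.mpr hs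
    rw [boundaryValue, if_neg (by linarith), neg_smul, ← sub_eq_add_neg]
  have hbm : ∀ s, s < 0 → -(Real.pi * m s) = boundaryValue A B x (-Real.exp s) := fun s hs => by
    have : Real.exp s < 1 := Real.exp_zero ▸ Real.exp_lt_exp.mpr hs
    rw [boundaryValue, if_pos (by linarith), neg_smul, ← sub_eq_add_neg]
  -- The boundary value changes its formula at $s=0$; on each side it agrees almost everywhere with
  -- a continuous function.
  have hne : ∀ᵐ s : ℝ, s ≠ 0 := by simp [ae_iff, measure_singleton]
  have e1 : ∀ᵐ s : ℝ, s ∈ Set.uIoc (-S) 0 →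
      -(Real.pi * m s) = boundaryValue A B x (-Real.exp s) := by
    filter_upwards [hne] with s hs hs'
    rw [Set.uIoc_of_le (by linarith)] at hs'
    exact hbm s (lt_of_le_of_ne hs'.2 hs)
  have e2 : ∀ᵐ s : ℝ, s ∈ Set.uIoc 0 S →
      -(Real.pi * p s) = boundaryValue A B x (-Real.exp s) := by
    filter_upwards with s hs'
    rw [Set.uIoc_of_le hS] at hs'
    exact hbp s hs'.1
  have i1 : IntervalIntegrable (fun s => -(Real.pi * m s)) volume (-S) 0 :=
    (continuous_const.mul hmc).neg.intervalIntegrable _ _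
  have i2 : IntervalIntegrable (fun s => -(Real.pi * p s)) volume 0 S :=
    (continuous_const.mul hpc).neg.intervalIntegrable _ _
  have i1' := i1.congr_ae ((ae_restrict_iff' measurableSet_uIoc).mpr e1)
  have i2' := i2.congr_ae ((ae_restrict_iff' measurableSet_uIoc).mpr e2)
  have hG : ContinuousOn (fun γ => (qf x (integrand A B γ)).re) (Real.exp '' Set.uIcc 0 S) :=
    (Complex.continuous_re.comp (continuous_qf x)).comp_continuousOn
      ((continuousOn_integrand hA hB).mono (by rintro _ ⟨s, -, rfl⟩; exact Real.exp_pos s))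
  have hsub := intervalIntegral.integral_comp_mul_deriv' (f := Real.exp) (f' := Real.exp)
    (a := 0) (b := S) (fun s _ => Real.hasDerivAt_exp s) Real.continuous_exp.continuousOn hG
  rw [Real.exp_zero] at hsub
  rw [partialIntegral, qf_intervalIntegral_integrand hA hB x le_rfl (Real.one_le_exp hS),
    Complex.ofReal_re, ← hsub, ← intervalIntegral.integral_add_adjacent_intervals i1' i2',
    ← intervalIntegral.integral_congr_ae e1, ← intervalIntegral.integral_congr_ae e2]
  have h3 := intervalIntegral.integral_comp_neg (a := 0) (b := S) (fun s => -(Real.pi * m s))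
  rw [neg_zero] at h3
  have i3 : IntervalIntegrable (fun s => -(Real.pi * m (-s))) volume 0 S :=
    (continuous_const.mul (hmc.comp continuous_neg)).neg.intervalIntegrable _ _
  rw [← h3, ← intervalIntegral.integral_add i3 i2,
    ← intervalIntegral.integral_const_mul, ← intervalIntegral.integral_neg]
  refine intervalIntegral.integral_congr fun s _ => ?_
  have h4 := congrArg (fun M => (qf x M).re) (exp_mul_integrand hA hB s)
  simp only [qf_add, qf_real_smul, Complex.re_ofReal_mul, Complex.add_re] at h4
  simp only [Function.comp, hp, hm]
  rw [mul_comm _ (Real.exp s), h4]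
  ring

theorem tendsto_qf_partialIntegral (hA : A.PosSemidef) (hB : B.PosDef) (x : Fin n → ℂ) :
    Tendsto (fun t => qf x (partialIntegral A B t)) atTop (𝓝 (qf x (Δ A B))) := by
  have h1 := tendsto_integral_boundaryValue hA hB x
  have h2 : Tendsto (fun S => (qf x (partialIntegral A B (Real.exp S))).re) atTop
      (𝓝 (qf x (Δ A B)).re) := by
    have h3 := (h1.const_mul (-Real.pi⁻¹))
    rw [show -Real.pi⁻¹ * -(Real.pi * (qf x (Δ A B)).re) = (qf x (Δ A B)).re by
      field_simp] at h3
    refine h3.congr' ?_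
    filter_upwards [eventually_ge_atTop 0] with S hS
    rw [integral_boundaryValue_eq hA.isHermitian hB.isHermitian x hS]
    field_simp
  have h4 : Tendsto (fun t => (((qf x (partialIntegral A B t)).re : ℝ) : ℂ)) atTop
      (𝓝 (((qf x (Δ A B)).re : ℝ) : ℂ)) := by
    refine (Complex.continuous_ofReal.tendsto _).comp ((h2.comp Real.tendsto_log_atTop).congr' ?_)
    filter_upwards [eventually_gt_atTop 0] with t ht
    simp [Real.exp_log ht]
  have h5 : qf x (Δ A B) = ((qf x (Δ A B)).re : ℂ) :=
    Complex.ext (by simp) (by simp [im_qf_Δ hA hB x])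
  rw [h5]
  refine h4.congr' ?_
  filter_upwards [eventually_ge_atTop 1] with t ht
  rw [partialIntegral, qf_intervalIntegral_integrand hA.isHermitian hB.isHermitian x le_rfl ht,
    Complex.ofReal_re]

end PartialIntegral

/-! ### Compatibility with isometries -/

section Isometry

variable {n r : ℕ} {V : Matrix (Fin n) (Fin r) ℂ}

/-- Conjugation `X ↦ V X Vᴴ` by an isometry, a homomorphism of non-unital star algebras. -/
def isometryConj (hV : Vᴴ * V = 1) :
    Matrix (Fin r) (Fin r) ℂ →⋆ₙₐ[ℝ] Matrix (Fin n) (Fin n) ℂ where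
  toFun X := V * X * Vᴴ
  map_smul' c X := by simp
  map_zero' := by simp
  map_add' X Y := by rw [Matrix.mul_add, Matrix.add_mul]
  map_mul' X Y := by
    have h : V * X * Vᴴ * (V * Y * Vᴴ) = V * X * (Vᴴ * V) * Y * Vᴴ := by
      simp only [Matrix.mul_assoc]
    rw [h, hV, Matrix.mul_one, Matrix.mul_assoc V X Y]
  map_star' X := by
    simp [Matrix.star_eq_conjTranspose, Matrix.conjTranspose_mul, Matrix.mul_assoc]

lemma isometryConj_apply (hV : Vᴴ * V = 1) (X : Matrix (Fin r) (Fin r) ℂ) :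
    isometryConj hV X = V * X * Vᴴ := rfl

lemma continuous_isometryConj (hV : Vᴴ * V = 1) : Continuous (isometryConj hV) := by
  change Continuous fun X : Matrix (Fin r) (Fin r) ℂ => V * X * Vᴴ
  fun_prop

lemma _root_.Matrix.IsHermitian.isometryConj {X : Matrix (Fin r) (Fin r) ℂ}
    (hX : X.IsHermitian) (V : Matrix (Fin n) (Fin r) ℂ) : (V * X * Vᴴ).IsHermitian :=
  Matrix.isHermitian_mul_mul_conjTranspose V hX

lemma continuousOn_quasispectrum (f : ℝ → ℝ) {m : ℕ} (X : Matrix (Fin m) (Fin m) ℂ) :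
    ContinuousOn f (quasispectrum ℝ X) := by
  refine Set.Finite.continuousOn ?_ f
  rw [quasispectrum_eq_spectrum_union_zero]
  exact X.finite_real_spectrum.union (Set.finite_singleton 0)

/-- Conjugation by a non-surjective isometry is not unital and adds the eigenvalue $0$; it respects
the non-unital calculus, which agrees with the unital one when $f(0)=0$. The convention `Real.log 0
= 0` brings the logarithm under this lemma. -/
lemma cfc_isometryConj (hV : Vᴴ * V = 1) {X : Matrix (Fin r) (Fin r) ℂ} (hX : X.IsHermitian)
    {f : ℝ → ℝ} (hf : f 0 = 0) : cfc f (V * X * Vᴴ) = V * cfc f X * Vᴴ := by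
  have hX' : IsSelfAdjoint (isometryConj hV X) := hX.isometryConj V
  have h := (isometryConj hV).map_cfcₙ f X (continuousOn_quasispectrum f X) hf
    (continuous_isometryConj hV) hX hX'
  rw [cfcₙ_eq_cfc (continuousOn_quasispectrum f X) hf,
    cfcₙ_eq_cfc (continuousOn_quasispectrum f _) hf] at h
  exact h.symm

lemma log_isometryConj (hV : Vᴴ * V = 1) {X : Matrix (Fin r) (Fin r) ℂ} (hX : X.IsHermitian) :
    CFC.log (V * X * Vᴴ) = V * CFC.log X * Vᴴ :=
  cfc_isometryConj hV hX Real.log_zero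

lemma posPart_isometryConj (hV : Vᴴ * V = 1) {X : Matrix (Fin r) (Fin r) ℂ} (hX : X.IsHermitian) :
    posPart (V * X * Vᴴ) = V * posPart X * Vᴴ := by
  rw [posPart_eq_cfc (hX.isometryConj V), posPart_eq_cfc hX, cfc_isometryConj hV hX (by simp)]

lemma O_isometryConj (hV : Vᴴ * V = 1) {A B : Matrix (Fin r) (Fin r) ℂ} (hA : A.IsHermitian)
    (hB : B.IsHermitian) (γ : ℝ) : O γ (V * A * Vᴴ) (V * B * Vᴴ) = V * O γ A B * Vᴴ := by
  rw [O, O, ← posPart_isometryConj hV (isHermitian_sub_real_smul hA hB γ), Matrix.mul_sub,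
    Matrix.sub_mul, Matrix.mul_smul, Matrix.smul_mul]

lemma integrand_isometryConj (hV : Vᴴ * V = 1) {A B : Matrix (Fin r) (Fin r) ℂ}
    (hA : A.IsHermitian) (hB : B.IsHermitian) (γ : ℝ) :
    integrand (V * A * Vᴴ) (V * B * Vᴴ) γ = V * integrand A B γ * Vᴴ := by
  rw [integrand, integrand, O_isometryConj hV hA hB, O_isometryConj hV hB hA, Matrix.mul_add,
    Matrix.add_mul, Matrix.mul_smul, Matrix.smul_mul, Matrix.mul_smul, Matrix.smul_mul]

lemma partialIntegral_isometryConj (hV : Vᴴ * V = 1) {A B : Matrix (Fin r) (Fin r) ℂ}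
    (hA : A.IsHermitian) (hB : B.IsHermitian) {t : ℝ} (ht : 1 ≤ t) :
    partialIntegral (V * A * Vᴴ) (V * B * Vᴴ) t = V * partialIntegral A B t * Vᴴ := by
  let L : Matrix (Fin r) (Fin r) ℂ →L[ℝ] Matrix (Fin n) (Fin n) ℂ :=
    ⟨(isometryConj hV : Matrix (Fin r) (Fin r) ℂ →ₗ[ℝ] Matrix (Fin n) (Fin n) ℂ),
      continuous_isometryConj hV⟩
  have h := L.intervalIntegral_comp_comm (intervalIntegrable_integrand hA hB le_rfl ht)
  rw [partialIntegral, partialIntegral]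
  refine Eq.trans ?_ h
  refine intervalIntegral.integral_congr fun γ _ => ?_
  exact integrand_isometryConj hV hA hB γ

lemma hasLineDerivAt_log_isometryConj (hV : Vᴴ * V = 1) {A B D : Matrix (Fin r) (Fin r) ℂ}
    (hA : A.IsHermitian) (hB : B.IsHermitian) (h : HasLineDerivAt ℝ CFC.log D B A) :
    HasLineDerivAt ℝ CFC.log (V * D * Vᴴ) (V * B * Vᴴ) (V * A * Vᴴ) := by
  let L : Matrix (Fin r) (Fin r) ℂ →L[ℝ] Matrix (Fin n) (Fin n) ℂ :=
    ⟨(isometryConj hV : Matrix (Fin r) (Fin r) ℂ →ₗ[ℝ] Matrix (Fin n) (Fin n) ℂ),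
      continuous_isometryConj hV⟩
  have h1 : HasDerivAt (fun t : ℝ => L (CFC.log (B + t • A))) (L D) 0 :=
    L.hasFDerivAt.comp_hasDerivAt (0 : ℝ) h
  change HasDerivAt _ _ _
  refine h1.congr_of_eventuallyEq (Eventually.of_forall fun t => ?_)
  change _ = V * CFC.log (B + t • A) * Vᴴ
  rw [← log_isometryConj hV (isHermitian_add_real_smul hB hA t), Matrix.mul_add, Matrix.add_mul,
    Matrix.mul_smul, Matrix.smul_mul]

lemma Δ_isometryConj (hV : Vᴴ * V = 1) {A B : Matrix (Fin r) (Fin r) ℂ} (hA : A.IsHermitian)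
    (hB : B.IsHermitian) (h : LineDifferentiableAt ℝ CFC.log B A) :
    Δ (V * A * Vᴴ) (V * B * Vᴴ) = V * Δ A B * Vᴴ := by
  have h1 := (hasLineDerivAt_log_isometryConj hV hA hB h.hasLineDerivAt).lineDeriv
  rw [Δ, Δ, Dlog, h1, log_isometryConj hV hA, log_isometryConj hV hB]
  simp only [← isometryConj_apply hV, ← map_sub, ← map_mul, ← map_add]
  rfl

end Isometry

/-! ### Compression to the range of `B` -/

section RangeBasis

variable {n r : ℕ} {A B : Matrix (Fin n) (Fin n) ℂ} {V : Matrix (Fin n) (Fin r) ℂ}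

lemma IsRangeBasis.exists_eq_mul (hV : IsRangeBasis B V) : ∃ C : Matrix (Fin r) (Fin n) ℂ, B = V * C := by
  have h : ∀ j, ∃ c : Fin r → ℂ, V *ᵥ c = B.col j := fun j => by
    have : B.col j ∈ LinearMap.range V.mulVecLin := by
      rw [hV.2]; exact ⟨Pi.single j 1, by simp⟩
    exact this
  choose c hc using h
  refine ⟨(Matrix.of c)ᵀ, ?_⟩
  ext i j
  exact (congrFun (hc j) i).symm

lemma IsRangeBasis.mul_mul_eq (hV : IsRangeBasis B V) : V * (Vᴴ * B) = B := by
  obtain ⟨C, rfl⟩ := hV.exists_eq_mul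
  rw [← Matrix.mul_assoc Vᴴ, hV.1, Matrix.one_mul]

lemma IsRangeBasis.exists_mulVec_eq (hV : IsRangeBasis B V) (c : Fin r → ℂ) :
    ∃ y, B *ᵥ y = V *ᵥ c := by
  have : V *ᵥ c ∈ LinearMap.range B.mulVecLin := by rw [← hV.2]; exact ⟨c, rfl⟩
  exact this

lemma IsRangeBasis.compress_eq (hV : IsRangeBasis B V) (hB : B.IsHermitian) :
    V * (Vᴴ * B * V) * Vᴴ = B := by
  have h1 : V * Vᴴ * B = B := by rw [Matrix.mul_assoc, hV.mul_mul_eq]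
  have h2 : B * (V * Vᴴ) = B := by
    have := congrArg Matrix.conjTranspose h1
    rwa [Matrix.conjTranspose_mul, Matrix.conjTranspose_mul, Matrix.conjTranspose_conjTranspose,
      hB.eq] at this
  calc V * (Vᴴ * B * V) * Vᴴ = V * Vᴴ * B * (V * Vᴴ) := by simp only [Matrix.mul_assoc]
    _ = B := by rw [h1, h2]

lemma IsRangeBasis.conjTranspose_mulVec_eq_zero (hV : IsRangeBasis B V) (hB : B.IsHermitian)
    {x : Fin n → ℂ} (hx : B *ᵥ x = 0) : Vᴴ *ᵥ x = 0 := by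
  have h : ∀ c, star (V *ᵥ c) ⬝ᵥ x = 0 := fun c => by
    obtain ⟨y, hy⟩ := hV.exists_mulVec_eq c
    rw [← hy, Matrix.star_mulVec, hB.eq, ← Matrix.dotProduct_mulVec, hx, dotProduct_zero]
  have := h (Vᴴ *ᵥ x)
  rw [Matrix.star_mulVec, ← Matrix.dotProduct_mulVec] at this
  exact dotProduct_star_self_eq_zero.mp this

/-- A null vector $c$ of the compression gives $Vc$ in both the range and the kernel of $B$, which
are orthogonal; hence $c=0$. -/
lemma IsRangeBasis.posDef_compress (hV : IsRangeBasis B V) (hB : B.PosSemidef) :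
    (Vᴴ * B * V).PosDef := by
  have h0 : (Vᴴ * B * V).PosSemidef := hB.conjTranspose_mul_mul_same V
  refine h0.posDef_iff_isUnit.mpr ?_
  rw [Matrix.isUnit_iff_isUnit_det, isUnit_iff_ne_zero]
  intro hdet
  obtain ⟨c, hc, hc0⟩ := Matrix.exists_mulVec_eq_zero_iff.mpr hdet
  have h1 : B *ᵥ (V *ᵥ c) = 0 := by
    have h3 : B = V * (Vᴴ * B) := hV.mul_mul_eq.symm
    rw [h3, Matrix.mulVec_mulVec, Matrix.mul_assoc, ← Matrix.mulVec_mulVec, hc0,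
      Matrix.mulVec_zero]
  have h2 := hV.conjTranspose_mulVec_eq_zero hB.isHermitian h1
  rw [Matrix.mulVec_mulVec, hV.1, Matrix.one_mulVec] at h2
  exact hc h2

lemma IsRangeBasis.compress_eq_of_ker_le (hV : IsRangeBasis B V) (hA : A.IsHermitian)
    (hB : B.IsHermitian) (hker : ∀ x, B *ᵥ x = 0 → A *ᵥ x = 0) :
    V * (Vᴴ * A * V) * Vᴴ = A := by
  have hBP : B * (1 - V * Vᴴ) = 0 := by
    have h1 := congrArg Matrix.conjTranspose hV.mul_mul_eq
    rw [Matrix.conjTranspose_mul, Matrix.conjTranspose_mul, Matrix.conjTranspose_conjTranspose,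
      hB.eq, Matrix.mul_assoc] at h1
    rw [Matrix.mul_sub, h1, Matrix.mul_one, sub_self]
  have hAP : A * (1 - V * Vᴴ) = 0 := by
    ext i j
    have := hker ((1 - V * Vᴴ) *ᵥ Pi.single j 1) (by rw [Matrix.mulVec_mulVec, hBP, Matrix.zero_mulVec])
    rw [Matrix.mulVec_mulVec, Matrix.mulVec_single_one] at this
    exact congrFun this i
  have h2 : A * (V * Vᴴ) = A := by
    rw [Matrix.mul_sub, Matrix.mul_one, sub_eq_zero] at hAP
    exact hAP.symm
  have h1 : V * Vᴴ * A = A := by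
    have := congrArg Matrix.conjTranspose h2
    rwa [Matrix.conjTranspose_mul, Matrix.conjTranspose_mul, Matrix.conjTranspose_conjTranspose,
      hA.eq] at this
  calc V * (Vᴴ * A * V) * Vᴴ = V * Vᴴ * A * (V * Vᴴ) := by simp only [Matrix.mul_assoc]
    _ = A := by rw [h1, h2]

lemma mulVec_eq_zero_of_qf_eq_zero (hA : A.PosSemidef) {x : Fin n → ℂ} (h : qf x A = 0) :
    A *ᵥ x = 0 := (hA.dotProduct_mulVec_zero_iff x).mp h

/-- The eigenvectors with nonzero eigenvalue form such a basis. -/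
lemma exists_isRangeBasis (hB : B.IsHermitian) :
    ∃ (r : ℕ) (V : Matrix (Fin n) (Fin r) ℂ), IsRangeBasis B V := by
  classical
  let J := {j : Fin n // hB.eigenvalues j ≠ 0}
  let e : Fin (Fintype.card J) ≃ J := (Fintype.equivFin J).symm
  let v := hB.eigenvectorBasis
  let V : Matrix (Fin n) (Fin (Fintype.card J)) ℂ := Matrix.of fun i k => (v (e k)).ofLp i
  have hVmul : ∀ c, V *ᵥ c = ∑ k, c k • (v (e k)).ofLp := fun c => by
    ext i
    simp [V, Matrix.mulVec, dotProduct, mul_comm]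
  refine ⟨Fintype.card J, V, ?_, le_antisymm ?_ ?_⟩
  · ext k l
    have h1 := orthonormal_iff_ite.mp v.orthonormal (e k) (e l)
    rw [EuclideanSpace.inner_eq_star_dotProduct] at h1
    rw [Matrix.mul_apply, Matrix.one_apply]
    simp only [Matrix.conjTranspose_apply, V, Matrix.of_apply]
    simp only [Subtype.coe_inj, EmbeddingLike.apply_eq_iff_eq] at h1
    rw [← h1, dotProduct]
    exact Finset.sum_congr rfl fun i _ => by simp [mul_comm]
  · rintro _ ⟨c, rfl⟩
    rw [Matrix.mulVecLin_apply, hVmul]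
    refine Submodule.sum_mem _ fun k _ => Submodule.smul_mem _ _ ?_
    refine ⟨((hB.eigenvalues (e k))⁻¹ : ℂ) • (v (e k)).ofLp, ?_⟩
    rw [Matrix.mulVecLin_apply, Matrix.mulVec_smul, hB.mulVec_eigenvectorBasis]
    ext i
    have := (e k).2
    simp [v, this]
  · rintro _ ⟨x, rfl⟩
    rw [Matrix.mulVecLin_apply]
    have hx : x = ∑ j, (inner ℂ (v j) (WithLp.toLp 2 x)) • (v j).ofLp := by
      have := congrArg WithLp.ofLp (v.sum_repr' (WithLp.toLp 2 x))
      simpa using this.symm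
    rw [hx, Matrix.mulVec_sum]
    refine Submodule.sum_mem _ fun j _ => ?_
    rw [Matrix.mulVec_smul]
    refine Submodule.smul_mem _ _ ?_
    rw [hB.mulVec_eigenvectorBasis]
    by_cases hj : hB.eigenvalues j = 0
    · rw [hj, zero_smul]; exact Submodule.zero_mem _
    · refine ⟨Pi.single (e.symm ⟨j, hj⟩) (hB.eigenvalues j : ℂ), ?_⟩
      rw [Matrix.mulVecLin_apply, hVmul, Finset.sum_eq_single (e.symm ⟨j, hj⟩)]
      · ext i; simp [v]
      · intro k _ hk; simp [hk]
      · simp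

end RangeBasis

/-! ### Norm bounds and monotonicity -/

section Bounds

variable {n : ℕ} {A B X : Matrix (Fin n) (Fin n) ℂ}

lemma nsq_eigenvectorBasis (hX : X.IsHermitian) (j : Fin n) :
    nsq (hX.eigenvectorBasis j).ofLp = 1 := by
  rw [nsq_eq_norm_sq, WithLp.toLp_ofLp, hX.eigenvectorBasis.orthonormal.1 j, one_pow]

lemma qf_eigenvectorBasis (hX : X.IsHermitian) (j : Fin n) :
    qf (hX.eigenvectorBasis j).ofLp X = hX.eigenvalues j := by
  rw [qf, hX.mulVec_eigenvectorBasis, dotProduct_smul, star_dotProduct_self,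
    nsq_eigenvectorBasis]
  simp

lemma norm_posPart_le (hX : X.IsHermitian) {c : ℝ} (hc : 0 ≤ c)
    (h : ∀ x, (qf x X).re ≤ c * nsq x) : ‖posPart X‖ ≤ c := by
  rw [posPart_eq_cfc hX]
  refine norm_cfc_le hc ?_
  rw [hX.spectrum_real_eq_range_eigenvalues]
  rintro _ ⟨j, rfl⟩
  have h1 := h (hX.eigenvectorBasis j).ofLp
  rw [qf_eigenvectorBasis, nsq_eigenvectorBasis, Complex.ofReal_re, mul_one] at h1
  rw [Real.norm_of_nonneg (le_max_right _ _)]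
  exact max_le h1 hc

lemma norm_O_le (hA : A.PosSemidef) (hB : B.IsHermitian) {γ : ℝ} (hγ : 0 ≤ γ) :
    ‖O γ B A‖ ≤ ‖B‖ := by
  refine norm_posPart_le (isHermitian_sub_real_smul hB hA.isHermitian γ) (norm_nonneg B) fun x => ?_
  rw [qf_sub, qf_real_smul, Complex.sub_re, Complex.re_ofReal_mul]
  have h1 := (Complex.re_le_norm _).trans (norm_qf_le x B)
  have h2 := mul_nonneg hγ (hA.qf_re x)
  linarith

lemma posSemidef_intervalIntegral_integrand (hA : A.IsHermitian) (hB : B.IsHermitian) {s t : ℝ}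
    (hs : 1 ≤ s) (hst : s ≤ t) : (∫ γ in s..t, integrand A B γ).PosSemidef := by
  refine posSemidef_iff_qf.mpr fun x => ?_
  rw [qf_intervalIntegral_integrand hA hB x hs (hs.trans hst), Complex.ofReal_re, Complex.ofReal_im]
  refine ⟨intervalIntegral.integral_nonneg hst fun γ hγ => ?_, rfl⟩
  exact (posSemidef_integrand hA hB (zero_le_one.trans (hs.trans hγ.1))).qf_re _

lemma partialIntegral_sub (hA : A.IsHermitian) (hB : B.IsHermitian) {s t : ℝ}
    (hs : 1 ≤ s) (ht : 1 ≤ t) :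
    partialIntegral A B t - partialIntegral A B s = ∫ γ in s..t, integrand A B γ :=
  intervalIntegral.integral_interval_sub_left (intervalIntegrable_integrand hA hB le_rfl ht)
    (intervalIntegrable_integrand hA hB le_rfl hs)

lemma posSemidef_of_tendsto_qf {ι : Type*} {l : Filter ι} [l.NeBot]
    {M : ι → Matrix (Fin n) (Fin n) ℂ} (hM : ∀ᶠ i in l, (M i).PosSemidef)
    (h : ∀ x, Tendsto (fun i => qf x (M i)) l (𝓝 (qf x X))) : X.PosSemidef := by
  refine posSemidef_iff_qf.mpr fun x => ⟨?_, ?_⟩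
  · refine ge_of_tendsto ((Complex.continuous_re.tendsto _).comp (h x)) ?_
    filter_upwards [hM] with i hi using hi.qf_re _
  · refine tendsto_nhds_unique ((Complex.continuous_im.tendsto _).comp (h x))
      (tendsto_const_nhds.congr' ?_)
    filter_upwards [hM] with i hi using ((posSemidef_iff_qf.mp hi x).2).symm

end Bounds

/-! ### The dominated case -/

section Dominated

variable {n r : ℕ} {A B : Matrix (Fin n) (Fin n) ℂ} {τ : ℝ} {V : Matrix (Fin n) (Fin r) ℂ}

lemma mulVec_eq_zero_of_le_smul (hA : A.PosSemidef) (hτ : (τ • B - A).PosSemidef) (x : Fin n → ℂ)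
    (hx : B *ᵥ x = 0) : A *ᵥ x = 0 := by
  refine mulVec_eq_zero_of_qf_eq_zero hA ?_
  have h1 := hτ.qf_re x
  have h2 : qf x B = 0 := by rw [qf, hx, dotProduct_zero]
  rw [qf_sub, qf_real_smul, h2, mul_zero, zero_sub, Complex.neg_re] at h1
  rw [hA.isHermitian.qf_eq_re, le_antisymm (neg_nonneg.mp h1) (hA.qf_re _), Complex.ofReal_zero]

/-- Beyond $\tau$ the first term vanishes, since $A\le\tau B\le\gamma B$, and the second is at most
$\gamma^{-2}\|B\|$. -/
lemma integrableOn_integrand_Ioi (hA : A.PosSemidef) (hB : B.PosSemidef) (h1 : 1 ≤ τ)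
    (hτ : (τ • B - A).PosSemidef) : IntegrableOn (integrand A B) (Set.Ioi 1) := by
  rw [← Set.Ioc_union_Ioi_eq_Ioi h1]
  refine IntegrableOn.union ?_ ?_
  · exact (intervalIntegrable_iff_integrableOn_Ioc_of_le h1).mp
      (intervalIntegrable_integrand hA.isHermitian hB.isHermitian le_rfl h1)
  · have hτ0 : 0 < τ := one_pos.trans_le h1
    refine Integrable.mono' ((integrableOn_Ioi_rpow_of_lt (by norm_num : (-2 : ℝ) < -1)
      hτ0).mul_const ‖B‖) ?_ ?_
    · exact ((continuousOn_integrand hA.isHermitian hB.isHermitian).mono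
        (Set.Ioi_subset_Ioi hτ0.le)).aestronglyMeasurable measurableSet_Ioi
    · refine (ae_restrict_iff' measurableSet_Ioi).mpr (Eventually.of_forall fun γ hγ => ?_)
      have hγ' : τ < γ := hγ
      have hγ0 : 0 < γ := hτ0.trans hγ'
      have h2 : O γ A B = 0 := by
        refine posPart_eq_zero ?_
        have h3 := hτ.add (hB.smul (sub_nonneg.mpr hγ'.le))
        convert h3 using 1
        rw [sub_smul]; abel
      rw [integrand, h2, smul_zero, zero_add, norm_smul, Real.rpow_neg hγ0.le, Real.rpow_two,
        Real.norm_of_nonneg (by positivity)]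
      gcongr
      exact norm_O_le hA hB.isHermitian hγ0.le

lemma lineDifferentiableAt_log_compress (hA : A.PosSemidef) (hB : B.PosSemidef)
    (hV : IsRangeBasis B V) : LineDifferentiableAt ℝ CFC.log (Vᴴ * B * V) (Vᴴ * A * V) :=
  (hasLineDerivAt_log (hA.conjTranspose_mul_mul_same V).isHermitian
    (hV.posDef_compress hB)).2.lineDifferentiableAt

lemma lineDifferentiableAt_log (hA : A.PosSemidef) (hB : B.PosSemidef)
    (hker : ∀ x, B *ᵥ x = 0 → A *ᵥ x = 0) : LineDifferentiableAt ℝ CFC.log B A := by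
  obtain ⟨r, V, hV⟩ := exists_isRangeBasis hB.isHermitian
  have h := hasLineDerivAt_log_isometryConj hV.1 (hA.conjTranspose_mul_mul_same V).isHermitian
    (hV.posDef_compress hB).isHermitian (lineDifferentiableAt_log_compress hA hB hV).hasLineDerivAt
  rw [hV.compress_eq hB.isHermitian,
    hV.compress_eq_of_ker_le hA.isHermitian hB.isHermitian hker] at h
  exact h.lineDifferentiableAt

lemma Δ_eq_compress (hA : A.PosSemidef) (hB : B.PosSemidef)
    (hker : ∀ x, B *ᵥ x = 0 → A *ᵥ x = 0) (hV : IsRangeBasis B V) :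
    Δ A B = V * Δ (Vᴴ * A * V) (Vᴴ * B * V) * Vᴴ := by
  rw [← Δ_isometryConj hV.1 (hA.conjTranspose_mul_mul_same V).isHermitian
    (hV.posDef_compress hB).isHermitian (lineDifferentiableAt_log_compress hA hB hV),
    hV.compress_eq hB.isHermitian, hV.compress_eq_of_ker_le hA.isHermitian hB.isHermitian hker]

lemma Δ_mulVec_eq_zero (hA : A.PosSemidef) (hB : B.PosSemidef)
    (hker : ∀ x, B *ᵥ x = 0 → A *ᵥ x = 0) {x : Fin n → ℂ} (hx : B *ᵥ x = 0) : Δ A B *ᵥ x = 0 := by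
  obtain ⟨r, V, hV⟩ := exists_isRangeBasis hB.isHermitian
  rw [Δ_eq_compress hA hB hker hV, ← Matrix.mulVec_mulVec,
    hV.conjTranspose_mulVec_eq_zero hB.isHermitian hx, Matrix.mulVec_zero]

/-- Both sides are compressed to the range of $B$, where the positive definite case applies to the
vector $V^*x$. -/
lemma tendsto_qf_partialIntegral_of_ker_le (hA : A.PosSemidef) (hB : B.PosSemidef)
    (hker : ∀ x, B *ᵥ x = 0 → A *ᵥ x = 0) (x : Fin n → ℂ) :
    Tendsto (fun t => qf x (partialIntegral A B t)) atTop (𝓝 (qf x (Δ A B))) := by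
  obtain ⟨r, V, hV⟩ := exists_isRangeBasis hB.isHermitian
  have hA1 := hA.conjTranspose_mul_mul_same V
  have hB1 := hV.posDef_compress hB
  have h := tendsto_qf_partialIntegral hA1 hB1 (Vᴴ *ᵥ x)
  rw [← qf_mul_mul_conjTranspose, ← Δ_eq_compress hA hB hker hV] at h
  refine h.congr' ?_
  filter_upwards [eventually_ge_atTop 1] with t ht
  rw [← qf_mul_mul_conjTranspose,
    ← partialIntegral_isometryConj hV.1 hA1.isHermitian hB1.isHermitian ht,
    hV.compress_eq hB.isHermitian, hV.compress_eq_of_ker_le hA.isHermitian hB.isHermitian hker]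

lemma posSemidef_Δ (hA : A.PosSemidef) (hB : B.PosSemidef)
    (hker : ∀ x, B *ᵥ x = 0 → A *ᵥ x = 0) : (Δ A B).PosSemidef := by
  refine posSemidef_of_tendsto_qf (l := atTop) (M := partialIntegral A B) ?_
    (tendsto_qf_partialIntegral_of_ker_le hA hB hker)
  filter_upwards [eventually_ge_atTop 1] with t ht using
    posSemidef_intervalIntegral_integrand hA.isHermitian hB.isHermitian le_rfl ht

lemma Δ_eq_integral (hA : A.PosSemidef) (hB : B.PosSemidef) (h1 : 1 ≤ τ)
    (hτ : (τ • B - A).PosSemidef) : Δ A B = ∫ γ in Set.Ioi (1 : ℝ), integrand A B γ := by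
  refine ext_qf fun x => tendsto_nhds_unique
    (tendsto_qf_partialIntegral_of_ker_le hA hB (mulVec_eq_zero_of_le_smul hA hτ) x) ?_
  exact ((continuous_qf x).tendsto _).comp (intervalIntegral_tendsto_integral_Ioi 1
    (integrableOn_integrand_Ioi hA hB h1 hτ) tendsto_id)

end Dominated

/-! ### The case without domination -/

section NotDominated

variable {n : ℕ} {A B X : Matrix (Fin n) (Fin n) ℂ} {x : Fin n → ℂ}

/-- On the range of $B$ one has $A_1\le\|A_1\|$ and $B_1\ge b>0$, so $\tau=\|A_1\|/b$ suffices; the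
maximum only secures $\tau\ge1$. -/
lemma exists_le_smul_of_ker_le (hA : A.PosSemidef) (hB : B.PosSemidef)
    (hker : ∀ x, B *ᵥ x = 0 → A *ᵥ x = 0) : ∃ τ : ℝ, 1 ≤ τ ∧ (τ • B - A).PosSemidef := by
  obtain ⟨r, V, hV⟩ := exists_isRangeBasis hB.isHermitian
  obtain ⟨b, hb, hb'⟩ := exists_pos_le_qf (hV.posDef_compress hB)
  set A₁ := Vᴴ * A * V with hA₁
  refine ⟨max 1 (‖A₁‖ / b), le_max_left _ _, posSemidef_iff_qf.mpr fun x => ⟨?_, ?_⟩⟩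
  · have hqB : qf x B = qf (Vᴴ *ᵥ x) (Vᴴ * B * V) := by
      rw [← qf_mul_mul_conjTranspose, hV.compress_eq hB.isHermitian]
    have hqA : qf x A = qf (Vᴴ *ᵥ x) A₁ := by
      rw [← qf_mul_mul_conjTranspose, hA₁,
        hV.compress_eq_of_ker_le hA.isHermitian hB.isHermitian hker]
    rw [qf_sub, qf_real_smul, Complex.sub_re, Complex.re_ofReal_mul, sub_nonneg]
    calc (qf x A).re ≤ ‖A₁‖ * nsq (Vᴴ *ᵥ x) := by
          rw [hqA]; exact (Complex.re_le_norm _).trans (norm_qf_le _ A₁)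
      _ = ‖A₁‖ / b * (b * nsq (Vᴴ *ᵥ x)) := by field_simp
      _ ≤ ‖A₁‖ / b * (qf x B).re := by
          rw [hqB]; gcongr; exact hb' _
      _ ≤ max 1 (‖A₁‖ / b) * (qf x B).re := by
          gcongr
          · exact hB.qf_re _
          · exact le_max_right _ _
  · rw [qf_sub, qf_real_smul, Complex.sub_im, Complex.im_ofReal_mul, hA.isHermitian.qf_im,
      hB.isHermitian.qf_im, mul_zero, sub_zero]

/-- The vector is chosen in the eigenbasis of $B$ because the definition of `trMulLog` refers to
that basis. If no such eigenvector existed, $A$ would annihilate the basis vectors of $\ker B$,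
hence all of $\ker B$. -/
lemma exists_qf_pos_of_not_le_smul (hA : A.PosSemidef) (hB : B.PosSemidef)
    (h : ¬∃ τ : ℝ, 1 ≤ τ ∧ (τ • B - A).PosSemidef) :
    ∃ j, hB.isHermitian.eigenvalues j = 0 ∧
      0 < (qf (hB.isHermitian.eigenvectorBasis j).ofLp A).re := by
  by_contra! hcon
  refine h (exists_le_smul_of_ker_le hA hB fun x hx => ?_)
  set v := hB.isHermitian.eigenvectorBasis
  have hx' : x = ∑ j, (inner ℂ (v j) (WithLp.toLp 2 x)) • (v j).ofLp := by
    have := congrArg WithLp.ofLp (v.sum_repr' (WithLp.toLp 2 x))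
    simpa using this.symm
  rw [hx', Matrix.mulVec_sum]
  refine Finset.sum_eq_zero fun j _ => ?_
  rw [Matrix.mulVec_smul]
  by_cases hj : hB.isHermitian.eigenvalues j = 0
  · have h0 : A *ᵥ (v j).ofLp = 0 := by
      refine mulVec_eq_zero_of_qf_eq_zero hA ?_
      rw [hA.isHermitian.qf_eq_re, le_antisymm (hcon j hj) (hA.qf_re _), Complex.ofReal_zero]
    rw [h0, smul_zero]
  -- An eigenvector with nonzero eigenvalue is orthogonal to $\ker B$, so its coefficient in `x`
  -- vanishes.
  · have h1 : star (B *ᵥ (v j).ofLp) ⬝ᵥ x = 0 := by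
      rw [Matrix.star_mulVec, hB.isHermitian.eq, ← Matrix.dotProduct_mulVec, hx, dotProduct_zero]
    rw [hB.isHermitian.mulVec_eigenvectorBasis] at h1
    have h2 : inner ℂ (v j) (WithLp.toLp 2 x) = 0 := by
      rw [EuclideanSpace.inner_eq_star_dotProduct, dotProduct_comm]
      rw [star_smul, smul_dotProduct] at h1
      rcases smul_eq_zero.mp h1 with h3 | h3
      · exact absurd (by simpa using h3) hj
      · exact h3
    rw [h2, zero_smul]

lemma qf_re_le_qf_posPart (hX : X.IsHermitian) : (qf x X).re ≤ (qf x (posPart X)).re := by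
  have h := (posSemidef_posPart hX.neg).qf_re x
  rw [posPart_neg hX, qf_sub, Complex.sub_re] at h
  linarith

lemma mul_log_le_qf_partialIntegral (hA : A.IsHermitian) (hB : B.IsHermitian) (hx : B *ᵥ x = 0)
    {t : ℝ} (ht : 1 ≤ t) : (qf x A).re * Real.log t ≤ (qf x (partialIntegral A B t)).re := by
  have hqB : qf x B = 0 := by rw [qf, hx, dotProduct_zero]
  rw [partialIntegral, qf_intervalIntegral_integrand hA hB x le_rfl ht, Complex.ofReal_re]
  have h0 : ∫ γ in (1 : ℝ)..t, (qf x A).re * γ⁻¹ = (qf x A).re * Real.log t := by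
    rw [intervalIntegral.integral_const_mul, integral_inv_of_pos one_pos (by linarith), div_one]
  rw [← h0]
  have hne : ∀ γ ∈ Set.uIcc 1 t, γ ≠ 0 := fun γ hγ => by
    rw [Set.uIcc_of_le ht] at hγ
    exact (one_pos.trans_le hγ.1).ne'
  refine intervalIntegral.integral_mono_on ht ?_ ?_ fun γ hγ => ?_
  · exact (intervalIntegral.intervalIntegrable_inv hne continuousOn_id).const_mul _
  · refine ContinuousOn.intervalIntegrable ?_
    refine (Complex.continuous_re.comp (continuous_qf x)).comp_continuousOn
      ((continuousOn_integrand hA hB).mono fun γ hγ => ?_)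
    rw [Set.uIcc_of_le ht] at hγ
    exact one_pos.trans_le hγ.1
  · have hγ0 : 0 < γ := one_pos.trans_le hγ.1
    have h1 := qf_re_le_qf_posPart (x := x) (isHermitian_sub_real_smul hA hB γ)
    rw [qf_sub, qf_real_smul, hqB, mul_zero, sub_zero] at h1
    have h2 := (posSemidef_O hB hA γ).qf_re x
    rw [integrand, qf_add, qf_real_smul, qf_real_smul, Complex.add_re, Complex.re_ofReal_mul,
      Complex.re_ofReal_mul, mul_comm]
    have h3 : γ⁻¹ * (qf x A).re ≤ γ⁻¹ * (qf x (O γ A B)).re :=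
      mul_le_mul_of_nonneg_left h1 (inv_nonneg.mpr hγ0.le)
    have h4 : 0 ≤ (γ ^ 2)⁻¹ * (qf x (O γ B A)).re := by positivity
    linarith

lemma tendsto_qf_partialIntegral_atTop (hA : A.IsHermitian) (hB : B.IsHermitian)
    (hx : B *ᵥ x = 0) (hpos : 0 < (qf x A).re) :
    Tendsto (fun t => (qf x (partialIntegral A B t)).re) atTop atTop := by
  refine tendsto_atTop_mono' atTop ?_ (Real.tendsto_log_atTop.const_mul_atTop hpos)
  filter_upwards [eventually_ge_atTop 1] with t ht using
    mul_log_le_qf_partialIntegral hA hB hx ht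

lemma tendsto_norm_atTop_of_qf {M : ℝ → Matrix (Fin n) (Fin n) ℂ}
    (h : Tendsto (fun t => (qf x (M t)).re) atTop atTop) :
    Tendsto (fun t => ‖M t‖) atTop atTop := by
  have hx : x ≠ 0 := by
    rintro rfl
    refine not_tendsto_const_atTop 0 atTop (h.congr fun t => ?_)
    simp [qf]
  refine tendsto_atTop_mono (fun t => ?_) (h.atTop_div_const (nsq_pos hx))
  rw [div_le_iff₀ (nsq_pos hx)]
  exact (Complex.re_le_norm _).trans (norm_qf_le x (M t))

/-- One summand of `trMulLog` is a positive number times $-\infty$, and in `EReal` adding anything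
to $\bot$ gives $\bot$. -/
lemma divergence_eq_top (hB : B.IsHermitian) {j : Fin n} (hj : hB.eigenvalues j = 0)
    (hpos : 0 < (qf (hB.eigenvectorBasis j).ofLp A).re) : divergence A hB = ⊤ := by
  have h : trMulLog A hB = ⊥ := by
    rw [qf] at hpos
    rw [trMulLog, ← Finset.add_sum_erase _ _ (Finset.mem_univ j), hj, ENNReal.ofReal_zero,
      ENNReal.log_zero, EReal.coe_mul_bot_of_pos hpos, EReal.bot_add]
  rw [divergence, h, EReal.coe_sub_bot]

lemma qf_re_le_trace_mul_nsq (hX : X.PosSemidef) : (qf x X).re ≤ X.trace.re * nsq x := by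
  have h0 := hX.isHermitian
  have h1 : qf x X = ∑ j, (h0.eigenvalues j : ℂ) * (‖coord h0 x j‖ : ℂ) ^ 2 := by
    conv_lhs => rw [← spec_ofReal h0]
    rw [qf_spec]
  rw [h1, h0.trace_eq_sum_eigenvalues, ← nsq_coord h0 x, Complex.re_sum, Complex.re_sum,
    Finset.sum_mul]
  refine Finset.sum_le_sum fun j _ => ?_
  rw [← Complex.ofReal_pow, ← Complex.ofReal_mul, Complex.ofReal_re]
  refine mul_le_mul_of_nonneg_left ?_ (hX.eigenvalues_nonneg j)
  exact Finset.single_le_sum (f := fun i => ‖coord h0 x i‖ ^ 2) (fun i _ => by positivity)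
    (Finset.mem_univ j)

lemma lintegral_const_mul_sub_inv {c : ℝ} (hc : 0 < c) :
    ∫⁻ t in Set.Ioo (1 : ℝ) 2, ENNReal.ofReal (c * (t - 1)⁻¹) = ⊤ := by
  by_contra hne
  have hm : AEStronglyMeasurable (fun t : ℝ => c * (t - 1)⁻¹) (volume.restrict (Set.Ioo 1 2)) := by
    fun_prop
  have hnn : 0 ≤ᵐ[volume.restrict (Set.Ioo (1 : ℝ) 2)] fun t => c * (t - 1)⁻¹ :=
    (ae_restrict_iff' measurableSet_Ioo).mpr (Eventually.of_forall fun t ht =>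
      mul_nonneg hc.le (inv_nonneg.mpr (sub_nonneg.mpr ht.1.le)))
  have h1 := (lintegral_ofReal_ne_top_iff_integrable hm hnn).mp hne
  have h2 : Integrable (fun t : ℝ => (t - 1)⁻¹) (volume.restrict (Set.Ioo 1 2)) := by
    have := h1.const_mul c⁻¹
    refine this.congr (Eventually.of_forall fun t => ?_)
    field_simp
  have h3 : IntervalIntegrable (fun t : ℝ => (t - 1)⁻¹) volume 1 2 :=
    (intervalIntegrable_iff_integrableOn_Ioo_of_le one_le_two).mpr h2
  rcases intervalIntegrable_sub_inv_iff.mp h3 with h | h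
  · norm_num at h
  · exact h Set.left_mem_uIcc

/-- For $t>1$ the trace of the negative part is at least $(t-1)\,x^*Ax/\|x\|^2$, because $Bx=0$.
Against the weight $1/(t(t-1)^2)$ this leaves a non-integrable $1/(t-1)$; restriction to $t<2$
replaces $1/t$ by $1/2$. -/
lemma frenkelIntegral_eq_top (hA : A.IsHermitian) (hB : B.IsHermitian) (hx : B *ᵥ x = 0)
    (hpos : 0 < (qf x A).re) : frenkelIntegral A B = ⊤ := by
  have hx0 : x ≠ 0 := by rintro rfl; simp [qf] at hpos
  have hn := nsq_pos hx0
  have hqB : qf x B = 0 := by rw [qf, hx, dotProduct_zero]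
  have hc : 0 < (qf x A).re / (2 * nsq x) := by positivity
  rw [eq_top_iff, ← lintegral_const_mul_sub_inv hc, frenkelIntegral]
  refine (setLIntegral_mono_ae' measurableSet_Ioo (Eventually.of_forall fun t ht => ?_)).trans
    (setLIntegral_le_lintegral _ _)
  refine ENNReal.ofReal_le_ofReal ?_
  have ht1 : 0 < t - 1 := sub_pos.mpr ht.1
  have ht2 : t < 2 := ht.2
  have ht0 : 0 < t := by linarith
  have hH : (-((1 - t) • A + t • B)).IsHermitian :=
    ((hA.smul (IsSelfAdjoint.all (1 - t))).add (hB.smul (IsSelfAdjoint.all t))).neg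
  have h1 := (qf_re_le_qf_posPart (x := x) hH).trans
    (qf_re_le_trace_mul_nsq (posSemidef_posPart hH))
  rw [qf_neg, qf_add, qf_real_smul, qf_real_smul, hqB, mul_zero, add_zero, Complex.neg_re,
    Complex.re_ofReal_mul] at h1
  rw [negPart, abs_of_pos ht0]
  set T := (posPart (-((1 - t) • A + t • B))).trace.re
  have h2 : (t - 1) * (qf x A).re / nsq x ≤ T := by
    rw [div_le_iff₀ hn]; linarith
  calc (qf x A).re / (2 * nsq x) * (t - 1)⁻¹
      ≤ (qf x A).re / (t * nsq x) * (t - 1)⁻¹ := by gcongr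
    _ = (t * (t - 1) ^ 2)⁻¹ * ((t - 1) * (qf x A).re / nsq x) := by field_simp
    _ ≤ _ := by gcongr

end NotDominated

end OperatorFrenkel

end

theorem theorem1 (n : ℕ) (A B : Matrix (Fin n) (Fin n) ℂ)
    (hA : A.PosSemidef) (hB : B.PosSemidef) :
    ((∃ τ : ℝ, 1 ≤ τ ∧ (τ • B - A).PosSemidef) →
      -- the derivative `D log[B](A)` exists, and `Δ(A‖B) ≥ 0`
      LineDifferentiableAt ℝ CFC.log B A ∧
      (OperatorFrenkel.Δ A B).PosSemidef ∧
      -- the integral converges and equals `Δ(A‖B)`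
      IntegrableOn (OperatorFrenkel.integrand A B) (Set.Ioi 1) ∧
      OperatorFrenkel.Δ A B = ∫ γ in Set.Ioi (1 : ℝ), OperatorFrenkel.integrand A B γ ∧
      -- on `range B ⊕ ker B`: `A = A₁ ⊕ 0`, `B = B₁ ⊕ 0` with `B₁ > 0`, the derivative
      -- `D log[B₁](A₁)` exists, and `Δ(A‖B) = Δ(A₁‖B₁) ⊕ 0`; here `A₁ = Vᴴ A V`, `B₁ = Vᴴ B V`
      -- are the restrictions to `range B`, in any orthonormal basis `V` of it
      (∃ (r : ℕ) (V : Matrix (Fin n) (Fin r) ℂ), OperatorFrenkel.IsRangeBasis B V) ∧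
      (∀ (r : ℕ) (V : Matrix (Fin n) (Fin r) ℂ), OperatorFrenkel.IsRangeBasis B V →
        A = V * (Vᴴ * A * V) * Vᴴ ∧
        B = V * (Vᴴ * B * V) * Vᴴ ∧
        (Vᴴ * B * V).PosDef ∧
        LineDifferentiableAt ℝ CFC.log (Vᴴ * B * V) (Vᴴ * A * V) ∧
        OperatorFrenkel.Δ A B = V * OperatorFrenkel.Δ (Vᴴ * A * V) (Vᴴ * B * V) * Vᴴ) ∧
      (∀ x : Fin n → ℂ, B *ᵥ x = 0 → OperatorFrenkel.Δ A B *ᵥ x = 0)) ∧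
    ((¬ ∃ τ : ℝ, 1 ≤ τ ∧ (τ • B - A).PosSemidef) →
      -- a vector `x` with `B x = 0` and `x* A x > 0`, along which the partial integrals diverge
      (∃ x : Fin n → ℂ, B *ᵥ x = 0 ∧ 0 < star x ⬝ᵥ A *ᵥ x ∧
        Tendsto (fun t : ℝ => (star x ⬝ᵥ OperatorFrenkel.partialIntegral A B t *ᵥ x).re)
          atTop atTop) ∧
      -- the partial integrals exist, are nonnegative and nondecreasing, and their norms tend to `∞`
      (∀ t : ℝ, 1 ≤ t → IntervalIntegrable (OperatorFrenkel.integrand A B) volume 1 t) ∧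
      (∀ t : ℝ, 1 ≤ t → (OperatorFrenkel.partialIntegral A B t).PosSemidef) ∧
      (∀ s t : ℝ, 1 ≤ s → s ≤ t →
        (OperatorFrenkel.partialIntegral A B t - OperatorFrenkel.partialIntegral A B s).PosSemidef) ∧
      Tendsto (fun t : ℝ => ‖OperatorFrenkel.partialIntegral A B t‖) atTop atTop ∧
      -- both sides of the trace formula are `∞`
      OperatorFrenkel.divergence A hB.isHermitian = ⊤ ∧
      OperatorFrenkel.frenkelIntegral A B = ⊤) := by
  constructor
  · rintro ⟨τ, h1, hτ⟩
    have hker := OperatorFrenkel.mulVec_eq_zero_of_le_smul hA hτ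
    exact ⟨OperatorFrenkel.lineDifferentiableAt_log hA hB hker,
      OperatorFrenkel.posSemidef_Δ hA hB hker,
      OperatorFrenkel.integrableOn_integrand_Ioi hA hB h1 hτ,
      OperatorFrenkel.Δ_eq_integral hA hB h1 hτ,
      OperatorFrenkel.exists_isRangeBasis hB.isHermitian,
      fun r V hV => ⟨(hV.compress_eq_of_ker_le hA.isHermitian hB.isHermitian hker).symm,
        (hV.compress_eq hB.isHermitian).symm, hV.posDef_compress hB,
        OperatorFrenkel.lineDifferentiableAt_log_compress hA hB hV,
        OperatorFrenkel.Δ_eq_compress hA hB hker hV⟩,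
      fun x hx => OperatorFrenkel.Δ_mulVec_eq_zero hA hB hker hx⟩
  · intro h
    have hA' := hA.isHermitian
    have hB' := hB.isHermitian
    obtain ⟨j, hj, hpos⟩ := OperatorFrenkel.exists_qf_pos_of_not_le_smul hA hB h
    have hx : B *ᵥ (hB'.eigenvectorBasis j).ofLp = 0 := by
      rw [hB'.mulVec_eigenvectorBasis, hj, zero_smul]
    have hlim := OperatorFrenkel.tendsto_qf_partialIntegral_atTop hA' hB' hx hpos
    refine ⟨⟨_, hx, Complex.pos_iff.mpr ⟨hpos, (hA'.qf_im _).symm⟩, hlim⟩,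
      fun t ht => OperatorFrenkel.intervalIntegrable_integrand hA' hB' le_rfl ht,
      fun t ht => OperatorFrenkel.posSemidef_intervalIntegral_integrand hA' hB' le_rfl ht,
      fun s t hs hst => ?_, OperatorFrenkel.tendsto_norm_atTop_of_qf hlim,
      OperatorFrenkel.divergence_eq_top hB' hj hpos,
      OperatorFrenkel.frenkelIntegral_eq_top hA' hB' hx hpos⟩
    rw [OperatorFrenkel.partialIntegral_sub hA' hB' hs (hs.trans hst)]
    exact OperatorFrenkel.posSemidef_intervalIntegral_integrand hA' hB' hs hst
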